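/- Let $\Gamma$ be a finite simple graph with vertex set $V$, and let $A_\Gamma^+=\langle e_i\ (i\in V): e_ie_j=e_je_i \text{ if } ij \text{ is an edge}\rangle$ be its right-angled Artin monoid. For $p\in A_\Gamma^+$ let $|p|$ be the number of generators (with multiplicity) in a word for $p$. For a finite set $U\subset A_\Gamma^+$ write $\vee U=r$ if $\bigcap_{p\in U}pA_\Gamma^+=rA_\Gamma^+$, and $\vee U=\infty$ if this intersection is empty. Let $\lambda_p\in B(\ell^2(A_\Gamma^+))$, $\lambda_pe_q=e_{pq}$, be the left regular representation, and let $C^*_\lambda(A_\Gamma^+)$ be the C*-algebra generated by $\{\lambda_p: p\in A_\Gamma^+\}$. A $\Gamma$-family on a complex Hilbert space $\mathcal H$ is a family of contractions $T=\{T_i\}_{i\in V}\subset B(\mathcal H)$ with $T_iT_j=T_jT_i$ whenever $ij$ is an edge; let $p\mapsto T_p$ be the unital representation of $A_\Gamma^+$ with $T_{e_i}=T_i$, and put $T_{\vee U}=0$ if $\vee U=\infty$. The family satisfies Brehmer's condition if for every clique $W$ of $\Gamma$ (including $W=\emptyset$), with $N_\Gamma(W)=\{e_i: ij \text{ is an edge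 for all } j\in W\}$, $$\sum_{U\subseteq N_\Gamma(W)}(-1)^{|U|}T_{\vee U}T_{\vee U}^*\ge 0 .$$ It satisfies the weak Brehmer condition if for each connected component of the complement graph $\Gamma^c$, with $\Gamma_i$ the subgraph of $\Gamma$ induced on the vertices of that component, $\{T_j: j\in\Gamma_i\}$ satisfies Brehmer's condition as a $\Gamma_i$-family. It has property (P) if there is $0\le\rho<1$ such that for all $\rho<r<1$ $$\Delta_{r,T}:=\sum_{U\subseteq\{e_i:\,i\in V\}}(-1)^{|U|}r^{2|U|}T_{\vee U}T_{\vee U}^*\ge 0 .$$ Theorem. Let $T$ be a $\Gamma$-family on $\mathcal H$ that satisfies the weak Brehmer condition and property (P). Then for every $0\le r<1$ the Cauchy transform $$C_{r,T}h=\sum_{p\in A_\Gamma^+}e_p\otimes r^{|p|}T_p^*h$$ is a well-defined bounded operator $\mathcal H\to\ell^2(A_\Gamma^+)\otimes\mathcal H$. With $K_{r,T}=(I\otimes\Delta_{r,T}^{1/2})C_{r,T}$ and $P_{r,T}(a)=K_{r,T}^*(a\otimes I_{\mathcal H})K_{r,T}$ for $\rho<r<1$, the limit $$\Phi_T(a)=\lim_{r\to1^-}P_{r,T}(a)$$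 exists in norm for every $a\in C^*_\lambda(A_\Gamma^+)$, and it defines a linear map $\Phi_T:C^*_\lambda(A_\Gamma^+)\to B(\mathcal H)$ (the Poisson transform) such that 1. $\Phi_T(\lambda_p\lambda_q^*)=T_pT_q^*$ for all $p,q\in A_\Gamma^+$; 2. $\Phi_T$ is unital and completely contractive; 3. $\Phi_T(\lambda_p)\Phi_T(\lambda_q)=\Phi_T(\lambda_{pq})$ for all $p,q\in A_\Gamma^+$. -/

import Mathlib

open scoped TensorProduct

noncomputable section

/-! ### Right-angled Artin monoids -/

/-- The commutation relations `e_i e_j = e_j e_i`, one for each edge `ij` of the graph. -/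
inductive RAAMRel {V : Type*} (Γ : SimpleGraph V) : FreeMonoid V → FreeMonoid V → Prop
  | comm {i j : V} (h : Γ.Adj i j) :
      RAAMRel Γ (FreeMonoid.of i * FreeMonoid.of j) (FreeMonoid.of j * FreeMonoid.of i)

/-- The right-angled Artin monoid `A_Γ⁺ = ⟨e_i : e_i e_j = e_j e_i if ij is an edge⟩`. -/
abbrev RAAM {V : Type*} (Γ : SimpleGraph V) : Type _ := PresentedMonoid (RAAMRel Γ)

namespace RAAM

variable {V : Type*} (Γ : SimpleGraph V)

/-- The generator `e_i`. -/
def gen (i : V) : RAAM Γ := PresentedMonoid.of (RAAMRel Γ) i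

/-- The homomorphism `|·|` to `(ℕ, +)` that takes the value `1` on every generator. -/
def lengthHom : RAAM Γ →* Multiplicative ℕ :=
  PresentedMonoid.lift (fun _ => Multiplicative.ofAdd 1) (by
    rintro _ _ ⟨_⟩
    simp)

/-- `|p|`: the number of generators, with multiplicity, in any word for `p`. -/
def length (p : RAAM Γ) : ℕ := Multiplicative.toAdd (lengthHom Γ p)

/-- The set of generators `{e_i : i ∈ S}`, as a finite subset of the monoid. -/
def gens [Finite V] (S : Set V) : Finset (RAAM Γ) := (Set.toFinite (gen Γ '' S)).toFinset

/-! #### Left cancellation -/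

open Classical in
/-- Auxiliary congruence: `u` and `v` represent the same element, contain the same letters, and
still represent the same element after the first occurrence of a given letter is removed. -/
def eraseCon : Con (FreeMonoid V) where
  r u v := PresentedMonoid.mk (RAAMRel Γ) u = PresentedMonoid.mk (RAAMRel Γ) v ∧
    ∀ i, (i ∈ u.toList ↔ i ∈ v.toList) ∧
      PresentedMonoid.mk (RAAMRel Γ) (FreeMonoid.ofList (u.toList.erase i)) =
        PresentedMonoid.mk (RAAMRel Γ) (FreeMonoid.ofList (v.toList.erase i))
  iseqv :=
    { refl := fun _ => ⟨rfl, fun _ => ⟨Iff.rfl, rfl⟩⟩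
      symm := fun h => ⟨h.1.symm, fun i => ⟨(h.2 i).1.symm, (h.2 i).2.symm⟩⟩
      trans := fun h k => ⟨h.1.trans k.1,
        fun i => ⟨(h.2 i).1.trans (k.2 i).1, (h.2 i).2.trans (k.2 i).2⟩⟩ }
  mul' := by
    intro u v w x h k
    refine ⟨by rw [map_mul, map_mul, h.1, k.1], fun i => ?_⟩
    obtain ⟨h1, h2⟩ := h.2 i
    obtain ⟨k1, k2⟩ := k.2 i
    refine ⟨by simp only [FreeMonoid.toList_mul, List.mem_append, h1, k1], ?_⟩
    simp only [FreeMonoid.toList_mul, List.erase_append]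
    by_cases hi : i ∈ u.toList
    · rw [if_pos hi, if_pos (h1.1 hi), FreeMonoid.ofList_append, FreeMonoid.ofList_append,
        map_mul, map_mul, h2, FreeMonoid.ofList_toList, FreeMonoid.ofList_toList, k.1]
    · rw [if_neg hi, if_neg (fun c => hi (h1.2 c)), FreeMonoid.ofList_append,
        FreeMonoid.ofList_append, map_mul, map_mul, k2, FreeMonoid.ofList_toList,
        FreeMonoid.ofList_toList, h.1]

theorem eraseCon_of_mk_eq {u v : FreeMonoid V}
    (h : PresentedMonoid.mk (RAAMRel Γ) u = PresentedMonoid.mk (RAAMRel Γ) v) :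
    eraseCon Γ u v := by
  classical
  have hle : conGen (RAAMRel Γ) ≤ eraseCon Γ := by
    refine Con.conGen_le.2 ?_
    rintro _ _ ⟨hij⟩
    rename_i i j
    refine ⟨PresentedMonoid.mk_eq_mk_of_rel (RAAMRel.comm hij), fun k => ⟨?_, ?_⟩⟩
    · simp [or_comm]
    · have hne : i ≠ j := hij.ne
      by_cases hki : k = i
      · subst hki
        simp [hne.symm]
      · by_cases hkj : k = j
        · subst hkj
          simp [hne]
        · have h1 : ¬ i = k := fun h => hki h.symm
          have h2 : ¬ j = k := fun h => hkj h.symm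
          simp only [FreeMonoid.toList_mul, FreeMonoid.toList_of, List.singleton_append,
            List.erase_cons, beq_iff_eq, h1, h2, if_false, List.erase_nil]
          exact PresentedMonoid.mk_eq_mk_of_rel (RAAMRel.comm hij)
  exact hle (PresentedMonoid.mk_eq_mk_iff.1 h)

theorem gen_mul_cancel (i : V) (x y : RAAM Γ) (h : gen Γ i * x = gen Γ i * y) : x = y := by
  classical
  obtain ⟨u, rfl⟩ := PresentedMonoid.surjective_mk x
  obtain ⟨v, rfl⟩ := PresentedMonoid.surjective_mk y
  have h' : PresentedMonoid.mk (RAAMRel Γ) (FreeMonoid.of i * u) =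
      PresentedMonoid.mk (RAAMRel Γ) (FreeMonoid.of i * v) := h
  have := ((eraseCon_of_mk_eq Γ h').2 i).2
  simpa [List.erase_cons] using this

instance : IsLeftCancelMul (RAAM Γ) where
  mul_left_cancel p := by
    obtain ⟨u, rfl⟩ := PresentedMonoid.surjective_mk p
    induction u with
    | one => intro x y h; simpa using h
    | of i => intro x y h; exact gen_mul_cancel Γ i x y h
    | mul u v hu hv =>
      intro x y h
      simp only [map_mul, mul_assoc] at h
      exact hv (hu h)

end RAAM

/-! ### The left regular representation and the reduced semigroup C*-algebra -/

/-- The Hilbert space `ℓ²(P)`. -/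
abbrev ELL2 (P : Type*) : Type _ := lp (fun _ : P => ℂ) 2

open Classical in
/-- The canonical basis vector `e_p` of `ℓ²(P)`. -/
def ell2Basis {P : Type*} (p : P) : ELL2 P := lp.single 2 p (1 : ℂ)

theorem orthonormal_ell2Basis (P : Type*) : Orthonormal ℂ (ell2Basis : P → ELL2 P) := by
  classical
  have h := (HilbertBasis.ofRepr (LinearIsometryEquiv.refl ℂ (ELL2 P))).orthonormal
  have e : ⇑(HilbertBasis.ofRepr (LinearIsometryEquiv.refl ℂ (ELL2 P))) =
      (ell2Basis : P → ELL2 P) := by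
    funext p
    have := (HilbertBasis.ofRepr (LinearIsometryEquiv.refl ℂ (ELL2 P))).repr_symm_single p
    rw [← this]
    rfl
  rwa [e] at h

section Regular

variable {P : Type*} [Monoid P] [IsLeftCancelMul P]

theorem orthonormal_shift (p : P) : Orthonormal ℂ (fun q : P => ell2Basis (p * q)) :=
  (orthonormal_ell2Basis P).comp (fun q => p * q) (mul_right_injective p)

/-- `λ_p ∈ B(ℓ²(P))`, the isometry with `λ_p e_q = e_{pq}`. -/
def leftRegular (p : P) : ELL2 P →L[ℂ] ELL2 P :=
  (orthonormal_shift p).orthogonalFamily.linearIsometry.toContinuousLinearMap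

theorem leftRegular_ell2Basis (p q : P) :
    leftRegular p (ell2Basis q) = ell2Basis (p * q) := by
  classical
  have h := (orthonormal_shift p).orthogonalFamily.linearIsometry_apply_single (i := q) (1 : ℂ)
  simp only [LinearIsometry.toSpanSingleton_apply, one_smul] at h
  rw [← h]
  simp only [leftRegular, ell2Basis, LinearIsometry.coe_toContinuousLinearMap]

variable (P) in
/-- The reduced semigroup C*-algebra `C*_λ(P) ⊆ B(ℓ²(P))`: the norm closed `*`-subalgebra
generated by the operators `λ_p`. -/
def reducedCStar : StarSubalgebra ℂ (ELL2 P →L[ℂ] ELL2 P) :=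
  (StarAlgebra.adjoin ℂ (Set.range (leftRegular (P := P)))).topologicalClosure

/-- `λ_p` as an element of `C*_λ(P)`. -/
def regElem (p : P) : reducedCStar P :=
  ⟨leftRegular p, StarSubalgebra.le_topologicalClosure _
    (StarAlgebra.subset_adjoin ℂ _ ⟨p, rfl⟩)⟩

end Regular

/-! ### Hilbert tensor products -/

/-- The Hilbert space tensor product, i.e. the completion of the algebraic tensor product. -/
abbrev HilbertTensor (E F : Type*) [NormedAddCommGroup E] [InnerProductSpace ℂ E]
    [NormedAddCommGroup F] [InnerProductSpace ℂ F] : Type _ :=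
  UniformSpace.Completion (E ⊗[ℂ] F)

section Tensor

variable {E F : Type*} [NormedAddCommGroup E] [InnerProductSpace ℂ E]
  [NormedAddCommGroup F] [InnerProductSpace ℂ F]

/-- The elementary tensor `x ⊗ y`. -/
def hTmul (x : E) (y : F) : HilbertTensor E F := ((x ⊗ₜ[ℂ] y : E ⊗[ℂ] F) : HilbertTensor E F)

/-- The operator `a ⊗ b`, the continuous extension of `x ⊗ y ↦ a x ⊗ b y`. -/
def hTensorOp (a : E →L[ℂ] E) (b : F →L[ℂ] F) : HilbertTensor E F →L[ℂ] HilbertTensor E F :=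
  (TensorProduct.mapL a b).completion

theorem hTensorOp_hTmul (a : E →L[ℂ] E) (b : F →L[ℂ] F) (x : E) (y : F) :
    hTensorOp a b (hTmul x y) = hTmul (a x) (b y) := by
  simp [hTensorOp, hTmul]

end Tensor

/-! ### Least common multiples -/

/-- `r` is a least common multiple `∨F` of `F` for `p ≤ x ↔ x ∈ pP`: the intersection of the
right ideals `pP`, `p ∈ F`, is `rP` (in a monoid, `p ∣ x` means `x ∈ pP`). -/
def IsJoin {P : Type*} [Monoid P] (F : Finset P) (r : P) : Prop :=
  ∀ x : P, (∀ p ∈ F, p ∣ x) ↔ r ∣ x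

/-! ### `Γ`-families -/

/-- A `Γ`-family: contractions `T_i` on `H`, indexed by the vertices of `Γ`, such that
`T_i T_j = T_j T_i` whenever `ij` is an edge. -/
structure GammaFamily {V : Type*} (Γ : SimpleGraph V) (H : Type*) [NormedAddCommGroup H]
    [InnerProductSpace ℂ H] where
  op : V → H →L[ℂ] H
  contractive : ∀ i, ‖op i‖ ≤ 1
  comm : ∀ i j, Γ.Adj i j → op i * op j = op j * op i

namespace GammaFamily

variable {V : Type*} {Γ : SimpleGraph V} {H : Type*} [NormedAddCommGroup H]
  [InnerProductSpace ℂ H]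

/-- The representation `p ↦ T_p` of `A_Γ⁺` with `T_{e_i} = T_i`. -/
def rep (T : GammaFamily Γ H) : RAAM Γ →* (H →L[ℂ] H) :=
  PresentedMonoid.lift T.op (by
    rintro _ _ ⟨h⟩
    simpa using T.comm _ _ h)

/-- The family `{T_j : j ∈ S}` for the induced subgraph on `S`. -/
def restrict (T : GammaFamily Γ H) (S : Set V) : GammaFamily (Γ.induce S) H where
  op i := T.op i
  contractive i := T.contractive i
  comm i j h := T.comm i j h

open Classical in
/-- `T_{∨U}`, with the convention `T_{∨U} = 0` if `∨U = ∞`. -/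
def joinOp (T : GammaFamily Γ H) (U : Finset (RAAM Γ)) : H →L[ℂ] H :=
  if h : ∃ r, IsJoin U r then T.rep h.choose else 0

variable [CompleteSpace H]

/-- `Z(F) = ∑_{U ⊆ F} (-1)^{|U|} T_{∨U} T_{∨U}^*`. -/
def Z (T : GammaFamily Γ H) (F : Finset (RAAM Γ)) : H →L[ℂ] H :=
  ∑ U ∈ F.powerset, (-1 : ℂ) ^ U.card • (T.joinOp U * star (T.joinOp U))

/-- `Δ_{r,T} = ∑_{U ⊆ {e_i : i ∈ V}} (-1)^{|U|} r^{2|U|} T_{∨U} T_{∨U}^*`. -/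
def defect [Finite V] (T : GammaFamily Γ H) (r : ℝ) : H →L[ℂ] H :=
  ∑ U ∈ (RAAM.gens Γ Set.univ).powerset,
    ((-1 : ℂ) ^ U.card * (r : ℂ) ^ (2 * U.card)) • (T.joinOp U * star (T.joinOp U))

/-- Brehmer's condition: `Z(N_Γ(W)) ≥ 0` for every clique `W` (the empty clique included), where
`N_Γ(W)` is the set of generators of the vertices adjacent to every element of `W`. -/
def Brehmer [Finite V] (T : GammaFamily Γ H) : Prop :=
  ∀ W : Set V, Γ.IsClique W → 0 ≤ T.Z (RAAM.gens Γ {i | ∀ j ∈ W, Γ.Adj i j})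

/-- The weak Brehmer condition: Brehmer's condition for the restriction of the family to (the
subgraph of `Γ` induced on) each connected component of the complement graph. -/
def WeakBrehmer [Finite V] (T : GammaFamily Γ H) : Prop :=
  ∀ c : Γᶜ.ConnectedComponent, (T.restrict c.supp).Brehmer

/-- Property (P): `Δ_{r,T} ≥ 0` for all `r < 1` close to `1`. -/
def PropertyP [Finite V] (T : GammaFamily Γ H) : Prop :=
  ∃ ρ : ℝ, 0 ≤ ρ ∧ ρ < 1 ∧ ∀ r : ℝ, ρ < r → r < 1 → 0 ≤ T.defect r

/-- `C h = ∑_p e_p ⊗ r^{|p|} T_p^* h` for all `h`, i.e. the bounded operator `C` is the Cauchy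
transform `C_{r,T}`. -/
def IsCauchyTransform (T : GammaFamily Γ H) (r : ℝ)
    (C : H →L[ℂ] HilbertTensor (ELL2 (RAAM Γ)) H) : Prop :=
  ∀ h : H, HasSum (fun p : RAAM Γ =>
    hTmul (ell2Basis p) (((r : ℂ) ^ RAAM.length Γ p) • (star (T.rep p)) h)) (C h)

open Classical in
/-- The Cauchy transform `C_{r,T} : H → ℓ²(A_Γ⁺) ⊗ H` (set to `0` in case the defining series does
not give a bounded operator). -/
def cauchyTransform (T : GammaFamily Γ H) (r : ℝ) : H →L[ℂ] HilbertTensor (ELL2 (RAAM Γ)) H :=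
  if h : ∃ C, T.IsCauchyTransform r C then h.choose else 0

/-- The Poisson kernel `K_{r,T} = (I ⊗ Δ_{r,T}^{1/2}) C_{r,T}`. -/
def poissonKernel [Finite V] (T : GammaFamily Γ H) (r : ℝ) :
    H →L[ℂ] HilbertTensor (ELL2 (RAAM Γ)) H :=
  (hTensorOp 1 (CFC.sqrt (T.defect r))).comp (T.cauchyTransform r)

/-- `P_{r,T}(a) = K_{r,T}^* (a ⊗ I) K_{r,T}` for `a ∈ C*_λ(A_Γ⁺)`. -/
def poissonMap [Finite V] (T : GammaFamily Γ H) (r : ℝ) (a : reducedCStar (RAAM Γ)) :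
    H →L[ℂ] H :=
  (ContinuousLinearMap.adjoint (T.poissonKernel r)).comp
    ((hTensorOp (a : ELL2 (RAAM Γ) →L[ℂ] ELL2 (RAAM Γ)) 1).comp (T.poissonKernel r))

end GammaFamily

/-! ### Complete contractivity -/

/-- A linear map on a subalgebra `S ⊆ B(E)` with values in `B(H)` is completely contractive if
`‖[φ(a_ij)]‖ ≤ ‖[a_ij]‖` for every `n` and every `n × n` matrix over `S`, with the C*-norms
of `M_n(B(E))` and `M_n(B(H))`. -/
def IsCompletelyContractive {E H : Type*} [NormedAddCommGroup E] [InnerProductSpace ℂ E]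
    [CompleteSpace E] [NormedAddCommGroup H] [InnerProductSpace ℂ H] [CompleteSpace H]
    (S : StarSubalgebra ℂ (E →L[ℂ] E)) (φ : S →ₗ[ℂ] (H →L[ℂ] H)) : Prop :=
  ∀ (n : ℕ) (a : Matrix (Fin n) (Fin n) S),
    ‖CStarMatrix.ofMatrix (a.map fun x => φ x)‖ ≤
      ‖CStarMatrix.ofMatrix (a.map fun x => (x : E →L[ℂ] E))‖

end

noncomputable section

open scoped Classical

namespace RAAM

variable {V : Type*} {Γ : SimpleGraph V}

/-! Everything rests on Möbius inversion in `A_Γ⁺` (`hasSum_sum_cliques`): for summable `g`, the sum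
over `p` of `∑_U (-1)^|U| g(p · ∨U)`, `U` running over cliques, is `g 1`. Indeed `q` lies in `A_Γ⁺ ·
∨U` exactly when `U` is a set of last letters of `q`, and an alternating sum over the subsets of a
nonempty set vanishes. The identity is used twice.

Boundedness of the Cauchy transform. Fix a multidegree `m : V → ℕ` and truncate `‖T_q^* h‖²` to
those `q` with `count q ≤ m`. The inverted sum has the terms `⟨Z(S_p) T_p^* h, T_p^* h⟩` with `S_p =
{i | count p i < m i}`. If `m` lives on one component of `Γᶜ` they are nonnegative, because
Brehmer's condition passes to every set of generators (`Brehmer.Z_nonneg`). The `p` of degree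
exactly `m` have `S_p = ∅`, so `∑ ‖T_p^* h‖² ≤ ‖h‖²` over them. Different components commute, so
factoring `p` along them gives this for every `m` (`WeakBrehmer.sum_norm_sq_le`). With weights
`r^{2|p|}`, the sum over `m` is then a product of `|V|` geometric series.

The Poisson kernel. Applied to `g q = r^{2|q|} ‖T_q^* h‖²`, the inversion says `‖K_r h‖ = ‖h‖`;
property (P) is what makes `Δ_r^{1/2}` available. Since `(λ_q^* ⊗ I) K_r = r^{|q|} K_r T_q^*`, it
follows that `P_r(λ_p λ_q^*) = r^{|p|+|q|} T_p T_q^*`, which converges as `r → 1`. The elements `λ_p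
λ_q^*` span a dense subspace of the C*-algebra, and compressions by isometries are completely
contractive. So the limit exists everywhere and inherits complete contractivity, and
multiplicativity on the `λ_p` is that of `p ↦ T_p`. -/

@[elab_as_elim]
theorem induction_gen_mul {motive : RAAM Γ → Prop} (p : RAAM Γ) (one : motive 1)
    (gen_mul : ∀ i p, motive p → motive (gen Γ i * p)) : motive p := by
  obtain ⟨u, rfl⟩ := PresentedMonoid.surjective_mk p
  induction u using FreeMonoid.inductionOn' with
  | one => simpa using one
  | of_mul i u ih => rw [map_mul]; exact gen_mul i _ ih

/-! #### Lengths and letter counts -/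

@[simp] theorem length_one : length Γ 1 = 0 := by simp [length]

@[simp] theorem length_mul (p q : RAAM Γ) : length Γ (p * q) = length Γ p + length Γ q := by
  simp [length]

@[simp] theorem length_gen (i : V) : length Γ (gen Γ i) = 1 := rfl

theorem length_eq_zero {p : RAAM Γ} : length Γ p = 0 ↔ p = 1 := by
  refine ⟨fun h => ?_, fun h => by simp [h]⟩
  induction p using induction_gen_mul with
  | one => rfl
  | gen_mul i p _ => simp at h

theorem eq_of_dvd_of_dvd {p q : RAAM Γ} (h : p ∣ q) (k : q ∣ p) : p = q := by
  obtain ⟨x, rfl⟩ := h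
  obtain ⟨y, hy⟩ := k
  have := congrArg (length Γ) hy
  simp only [length_mul] at this
  rw [length_eq_zero.1 (show length Γ x = 0 by omega), mul_one]

/-- The homomorphism to `(ℕ^V, +)` that counts the occurrences of each generator. -/
def countHom : RAAM Γ →* Multiplicative (V → ℕ) :=
  PresentedMonoid.lift (fun i => Multiplicative.ofAdd (Pi.single i 1)) (by
    rintro _ _ ⟨_⟩
    simp [mul_comm])

/-- The number of occurrences of each generator in a word for `p`. -/
def count (p : RAAM Γ) : V → ℕ := Multiplicative.toAdd (countHom p)

@[simp] theorem count_one : count (1 : RAAM Γ) = 0 := by simp [count]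

@[simp] theorem count_mul (p q : RAAM Γ) : count (p * q) = count p + count q := by
  simp [count]

@[simp] theorem count_gen (i : V) : count (gen Γ i) = Pi.single i 1 := rfl

theorem sum_count [Fintype V] (p : RAAM Γ) : ∑ i, count p i = length Γ p := by
  induction p using induction_gen_mul with
  | one => simp
  | gen_mul i p ih => simp [Finset.sum_add_distrib, ih]

theorem finite_length_le [Finite V] (n : ℕ) : {p : RAAM Γ | length Γ p ≤ n}.Finite := by
  refine ((List.finite_length_le V n).image
    fun l => PresentedMonoid.mk (RAAMRel Γ) (FreeMonoid.ofList l)).subset ?_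
  intro p hp
  obtain ⟨u, rfl⟩ := PresentedMonoid.surjective_mk p
  refine ⟨u.toList, ?_, rfl⟩
  have : length Γ (PresentedMonoid.mk (RAAMRel Γ) u) = u.toList.length := by
    clear hp
    induction u using FreeMonoid.inductionOn' with
    | one => simp
    | of_mul i u ih =>
      rw [map_mul, length_mul, ih]
      change length Γ (gen Γ i) + _ = _
      simp [add_comm]
  simpa [this] using hp

theorem finite_count_le [Finite V] (m : V → ℕ) : {p : RAAM Γ | count p ≤ m}.Finite := by
  cases nonempty_fintype V
  refine (finite_length_le (Γ := Γ) (∑ i, m i)).subset fun p hp => ?_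
  rw [Set.mem_ofPred_eq, ← sum_count]
  exact Finset.sum_le_sum fun i _ => hp i

/-! #### First letters -/

/-- If `i` and `j` were not adjacent, killing all other letters would respect the relations and map
to a free monoid, where the first letter of a word is well defined. -/
theorem adj_of_gen_mul_eq {i j : V} (hij : i ≠ j) {x y : RAAM Γ}
    (h : gen Γ i * x = gen Γ j * y) : Γ.Adj i j := by
  by_contra hadj
  let f : V → FreeMonoid V := fun k => if k = i ∨ k = j then FreeMonoid.of k else 1
  let F : RAAM Γ →* FreeMonoid V := PresentedMonoid.lift f (by
    rintro _ _ ⟨hab⟩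
    rename_i a b
    simp only [map_mul, FreeMonoid.lift_eval_of]
    by_cases ha : a = i ∨ a = j
    · have hb : ¬ (b = i ∨ b = j) := by
        have := hab.ne
        have := hab.symm
        rintro (rfl | rfl) <;> rcases ha with rfl | rfl <;> contradiction
      simp [f, hb]
    · simp [f, ha])
  have hF := congrArg F h
  have hgen : ∀ k, F (gen Γ k) = f k := fun k => rfl
  rw [map_mul, map_mul, hgen, hgen] at hF
  simp only [f, true_or, or_true, if_true] at hF
  have := congrArg (fun w => w.toList.head?) hF
  simp at this
  exact hij this

/-- By `eraseCon`, deleting the first `i` from both words keeps them equal. On the right this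
deletion happens behind the leading `j`, which exhibits `j` as a first letter of `x`. -/
theorem exists_of_gen_mul_eq {i j : V} (hij : i ≠ j) {x y : RAAM Γ}
    (h : gen Γ i * x = gen Γ j * y) :
    Γ.Adj i j ∧ ∃ z, x = gen Γ j * z ∧ y = gen Γ i * z := by
  have hadj := adj_of_gen_mul_eq hij h
  refine ⟨hadj, ?_⟩
  obtain ⟨u, rfl⟩ := PresentedMonoid.surjective_mk x
  obtain ⟨v, rfl⟩ := PresentedMonoid.surjective_mk y
  have h' : PresentedMonoid.mk (RAAMRel Γ) (FreeMonoid.of i * u) =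
      PresentedMonoid.mk (RAAMRel Γ) (FreeMonoid.of j * v) := h
  have h2 := ((eraseCon_of_mk_eq Γ h').2 i).2
  have hx : PresentedMonoid.mk (RAAMRel Γ) u =
      gen Γ j * PresentedMonoid.mk (RAAMRel Γ) (FreeMonoid.ofList (v.toList.erase i)) := by
    simp only [FreeMonoid.toList_mul, FreeMonoid.toList_of, List.singleton_append,
      List.erase_cons, beq_iff_eq, hij.symm, if_false, beq_self_eq_true, if_true,
      FreeMonoid.ofList_toList] at h2
    rw [h2]
    rfl
  refine ⟨_, hx, gen_mul_cancel Γ j _ _ ?_⟩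
  have hc : gen Γ i * gen Γ j = gen Γ j * gen Γ i :=
    PresentedMonoid.mk_eq_mk_of_rel (RAAMRel.comm hadj)
  rw [← h, hx, ← mul_assoc, ← mul_assoc, hc]

theorem gen_injective : Function.Injective (gen Γ) := by
  intro i j h
  by_contra hij
  have := congrFun (congrArg count h) i
  simp [hij] at this

theorem gen_comm {i j : V} (h : Γ.Adj i j) : gen Γ i * gen Γ j = gen Γ j * gen Γ i :=
  PresentedMonoid.mk_eq_mk_of_rel (RAAMRel.comm h)

theorem forall_gen_dvd_iff {l : List V} (hl : l.Pairwise Γ.Adj) (x : RAAM Γ) :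
    (∀ i ∈ l, gen Γ i ∣ x) ↔ (l.map (gen Γ)).prod ∣ x := by
  induction l generalizing x with
  | nil => simp
  | cons i l ih =>
    rw [List.pairwise_cons] at hl
    rw [List.map_cons, List.prod_cons]
    constructor
    · intro h
      obtain ⟨x, rfl⟩ := h i (by simp)
      refine mul_dvd_mul_left _ ((ih hl.2 x).1 fun j hj => ?_)
      obtain ⟨y, hy⟩ := h j (by simp [hj])
      obtain ⟨-, z, rfl, -⟩ := exists_of_gen_mul_eq (hl.1 j hj).ne hy
      exact dvd_mul_right _ _
    · intro h j hj
      refine dvd_trans ?_ h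
      rcases List.mem_cons.1 hj with rfl | hj
      · exact dvd_mul_right _ _
      · obtain ⟨y, hy⟩ := (ih hl.2 _).2 dvd_rfl j hj
        exact ⟨gen Γ i * y, by rw [hy, ← mul_assoc, ← mul_assoc, gen_comm (hl.1 j hj)]⟩

/-! #### Reversal and last letters -/

/-- Reversal of words, as a homomorphism to the opposite monoid. -/
def revHom : RAAM Γ →* (RAAM Γ)ᵐᵒᵖ :=
  PresentedMonoid.lift (fun i => MulOpposite.op (gen Γ i)) (by
    rintro _ _ ⟨h⟩
    simp only [map_mul, FreeMonoid.lift_eval_of, ← MulOpposite.op_mul, gen_comm h])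

/-- Reversal of words. -/
def rev (p : RAAM Γ) : RAAM Γ := (revHom p).unop

@[simp] theorem rev_one : rev (1 : RAAM Γ) = 1 := by simp [rev]

@[simp] theorem rev_mul (p q : RAAM Γ) : rev (p * q) = rev q * rev p := by simp [rev]

@[simp] theorem rev_gen (i : V) : rev (gen Γ i) = gen Γ i := rfl

@[simp] theorem rev_rev (p : RAAM Γ) : rev (rev p) = p := by
  induction p using induction_gen_mul with
  | one => simp
  | gen_mul i p ih => simp [ih]

theorem rev_prod (l : List V) : rev (l.map (gen Γ)).prod = (l.reverse.map (gen Γ)).prod := by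
  induction l with
  | nil => simp
  | cons i l ih => simp [ih]

instance : IsRightCancelMul (RAAM Γ) where
  mul_right_cancel p q r h := by
    have := congrArg rev h
    simp only [rev_mul] at this
    simpa using congrArg rev (mul_left_cancel this)

theorem exists_mul_eq_iff (p q : RAAM Γ) : (∃ y, y * p = q) ↔ rev p ∣ rev q := by
  constructor
  · rintro ⟨y, rfl⟩
    simp
  · rintro ⟨y, hy⟩
    exact ⟨rev y, by simpa using (congrArg rev hy).symm⟩

/-- The set of last letters of `q`. -/
def lastLetters [Fintype V] (q : RAAM Γ) : Finset V :=
  Finset.univ.filter fun i => ∃ y, y * gen Γ i = q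

theorem lastLetters_eq_empty [Fintype V] {q : RAAM Γ} : lastLetters q = ∅ ↔ q = 1 := by
  constructor
  · intro h
    rw [← rev_rev q]
    generalize hp : rev q = p
    induction p using induction_gen_mul with
    | one => simp
    | gen_mul i p _ =>
      have : i ∈ lastLetters q := by
        simp [lastLetters, exists_mul_eq_iff, hp]
      simp [h] at this
  · rintro rfl
    refine Finset.eq_empty_of_forall_notMem fun i hi => ?_
    obtain ⟨y, hy⟩ := (Finset.mem_filter.1 hi).2
    simpa using congrArg (length Γ) hy

/-- The product of the generators in `U`; the order of the factors matters only if `U` is not a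
clique. -/
def cliqueProd (Γ : SimpleGraph V) (U : Finset V) : RAAM Γ := (U.toList.map (gen Γ)).prod

theorem pairwise_toList {U : Finset V} (hU : Γ.IsClique (U : Set V)) :
    U.toList.Pairwise Γ.Adj :=
  U.nodup_toList.pairwise_of_forall_ne fun i hi j hj hij =>
    hU (by simpa using hi) (by simpa using hj) hij

/-! ### Cliques, joins and Möbius inversion -/

theorem isJoin_cliqueProd {U : Finset V} (hU : Γ.IsClique (U : Set V)) :
    IsJoin (U.image (gen Γ)) (cliqueProd Γ U) := by
  intro x
  rw [cliqueProd, ← forall_gen_dvd_iff (pairwise_toList hU)]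
  simp

theorem isClique_of_isJoin {U : Finset V} {r : RAAM Γ} (h : IsJoin (U.image (gen Γ)) r) :
    Γ.IsClique (U : Set V) := by
  intro i hi j hj hij
  have hr := (h r).2 dvd_rfl
  obtain ⟨x, hx⟩ := hr (gen Γ i) (Finset.mem_image_of_mem _ hi)
  obtain ⟨y, hy⟩ := hr (gen Γ j) (Finset.mem_image_of_mem _ hj)
  exact adj_of_gen_mul_eq hij (hx.symm.trans hy)

theorem IsJoin.unique {F : Finset (RAAM Γ)} {r s : RAAM Γ} (hr : IsJoin F r) (hs : IsJoin F s) :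
    r = s :=
  eq_of_dvd_of_dvd ((hr s).1 ((hs s).2 dvd_rfl)) ((hs r).1 ((hr r).2 dvd_rfl))

theorem length_cliqueProd (U : Finset V) : length Γ (cliqueProd Γ U) = U.card := by
  rw [← Finset.length_toList, cliqueProd]
  induction U.toList with
  | nil => simp
  | cons i l ih => simp [ih, add_comm]

theorem count_cliqueProd (U : Finset V) (i : V) :
    count (cliqueProd Γ U) i = if i ∈ U then 1 else 0 := by
  have : ∀ l : List V, count (l.map (gen Γ)).prod i = l.count i := by
    intro l
    induction l with
    | nil => simp
    | cons j l ih => simp [ih, List.count_cons, Pi.single_apply, add_comm, eq_comm (a := i)]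
  rw [cliqueProd, this, List.Nodup.count U.nodup_toList]
  simp

/-- Reversal turns last letters into first letters, where distinct ones are adjacent and
divisibility by each means divisibility by their product. -/
theorem subset_lastLetters_iff [Fintype V] {U : Finset V} {q : RAAM Γ} :
    U ⊆ lastLetters q ↔ Γ.IsClique (U : Set V) ∧ ∃ y, y * cliqueProd Γ U = q := by
  have key : Γ.IsClique (U : Set V) → (U ⊆ lastLetters q ↔ ∃ y, y * cliqueProd Γ U = q) := by
    intro hU
    have hp : U.toList.reverse.Pairwise Γ.Adj := by
      rw [List.pairwise_reverse]
      exact (pairwise_toList hU).imp fun h => h.symm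
    rw [exists_mul_eq_iff, cliqueProd, rev_prod, ← forall_gen_dvd_iff hp]
    simp [lastLetters, Finset.subset_iff, exists_mul_eq_iff]
  refine ⟨fun h => ?_, fun h => (key h.1).2 h.2⟩
  suffices hU : Γ.IsClique (U : Set V) from ⟨hU, (key hU).1 h⟩
  intro i hi j hj hij
  obtain ⟨x, hx⟩ := (exists_mul_eq_iff _ _).1 (Finset.mem_filter.1 (h hi)).2
  obtain ⟨y, hy⟩ := (exists_mul_eq_iff _ _).1 (Finset.mem_filter.1 (h hj)).2
  exact adj_of_gen_mul_eq hij (hx.symm.trans hy)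

/-- The finite cliques of `Γ`. -/
def cliques [Fintype V] (Γ : SimpleGraph V) : Finset (Finset V) :=
  Finset.univ.filter fun U => Γ.IsClique (U : Set V)

/-- Möbius inversion on the right-angled Artin monoid. -/
theorem hasSum_sum_cliques [Fintype V] {g : RAAM Γ → ℝ} (hg : Summable g) :
    HasSum (fun p => ∑ U ∈ cliques Γ, (-1 : ℝ) ^ U.card * g (p * cliqueProd Γ U)) (g 1) := by
  let R : Finset V → Set (RAAM Γ) := fun U => Set.range (· * cliqueProd Γ U)
  have hR : ∀ U, HasSum (fun p => g (p * cliqueProd Γ U)) (∑' q, (R U).indicator g q) := by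
    intro U
    have h1 : HasSum ((R U).indicator g) (∑' q, (R U).indicator g q) := (hg.indicator _).hasSum
    have h2 : Function.Injective (· * cliqueProd Γ U) := mul_left_injective _
    rw [← h2.hasSum_iff (fun x hx => Set.indicator_of_notMem hx g)] at h1
    convert h1 using 2 with p
    exact (Set.indicator_of_mem (Set.mem_range_self p) g).symm
  -- For fixed `q`, the cliques `U` with `q ∈ R U` are the subsets of `lastLetters q`, which is
  -- empty only for `q = 1`.
  have hq : ∀ q, ∑ U ∈ cliques Γ, (-1 : ℝ) ^ U.card * (R U).indicator g q =
      if q = 1 then g 1 else 0 := by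
    intro q
    have h1 : ∑ U ∈ cliques Γ, (-1 : ℝ) ^ U.card * (R U).indicator g q =
        (∑ U ∈ (lastLetters q).powerset, (-1 : ℝ) ^ U.card) * g q := by
      rw [Finset.sum_mul]
      have : (lastLetters q).powerset = (cliques Γ).filter fun U => q ∈ R U := by
        ext U
        simp [cliques, subset_lastLetters_iff, R]
      rw [this, Finset.sum_filter]
      refine Finset.sum_congr rfl fun U _ => ?_
      by_cases h : q ∈ R U <;> simp [h]
    have h2 : (∑ U ∈ (lastLetters q).powerset, (-1 : ℝ) ^ U.card) = if q = 1 then 1 else 0 := by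
      have := congrArg (Int.cast : ℤ → ℝ) (Finset.sum_powerset_neg_one_pow_card (x := lastLetters q))
      simpa [lastLetters_eq_empty] using this
    rw [h1, h2]
    split_ifs with h <;> simp [h]
  have h1 : HasSum (fun p => ∑ U ∈ cliques Γ, (-1 : ℝ) ^ U.card * g (p * cliqueProd Γ U))
      (∑ U ∈ cliques Γ, (-1 : ℝ) ^ U.card * ∑' q, (R U).indicator g q) :=
    hasSum_sum fun U _ => (hR U).mul_left _
  have h2 : HasSum (fun q => ∑ U ∈ cliques Γ, (-1 : ℝ) ^ U.card * (R U).indicator g q)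
      (∑ U ∈ cliques Γ, (-1 : ℝ) ^ U.card * ∑' q, (R U).indicator g q) :=
    hasSum_sum fun U _ => ((hg.indicator _).hasSum).mul_left _
  simp_rw [hq] at h2
  rwa [h2.unique (hasSum_ite_eq 1 (g 1))] at h1

end RAAM

namespace GammaFamily

open RAAM

variable {V : Type*} {Γ : SimpleGraph V} {H : Type*} [NormedAddCommGroup H]
  [InnerProductSpace ℂ H]

/-! ### Joins of sets of generators -/

theorem joinOp_of_isJoin (T : GammaFamily Γ H) {U : Finset (RAAM Γ)} {r : RAAM Γ}
    (h : IsJoin U r) : T.joinOp U = T.rep r := by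
  have h' : ∃ r, IsJoin U r := ⟨r, h⟩
  rw [joinOp, dif_pos h', h'.choose_spec.unique h]

theorem joinOp_image (T : GammaFamily Γ H) (U : Finset V) :
    T.joinOp (U.image (gen Γ)) =
      if Γ.IsClique (U : Set V) then T.rep (cliqueProd Γ U) else 0 := by
  split_ifs with h
  · exact T.joinOp_of_isJoin (isJoin_cliqueProd h)
  · rw [joinOp, dif_neg]
    rintro ⟨r, hr⟩
    exact h (isClique_of_isJoin hr)

theorem joinOp_image_insert (T : GammaFamily Γ H) {i : V} {U : Finset V} (hi : i ∉ U) :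
    T.joinOp ((insert i U).image (gen Γ)) =
      if ∀ j ∈ U, Γ.Adj i j then T.op i * T.joinOp (U.image (gen Γ)) else 0 := by
  have hins : Γ.IsClique ((insert i U : Finset V) : Set V) ↔
      Γ.IsClique (U : Set V) ∧ ∀ j ∈ U, Γ.Adj i j := by
    rw [Finset.coe_insert, SimpleGraph.isClique_insert_of_notMem (by simpa using hi)]
    simp
  by_cases hU : Γ.IsClique (U : Set V) ∧ ∀ j ∈ U, Γ.Adj i j
  -- `cliqueProd` of the enlarged set may list `i` anywhere; uniqueness of joins lets `i` be put
  -- first without reordering.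
  · have hj : IsJoin ((insert i U).image (gen Γ)) (gen Γ i * cliqueProd Γ U) := by
      have hp : (i :: U.toList).Pairwise Γ.Adj :=
        List.pairwise_cons.2 ⟨fun j hj => hU.2 j (by simpa using hj), pairwise_toList hU.1⟩
      intro x
      have := forall_gen_dvd_iff hp x
      rw [List.map_cons, List.prod_cons] at this
      rw [cliqueProd, ← this]
      simp
    rw [T.joinOp_of_isJoin hj, if_pos hU.2, T.joinOp_image, if_pos hU.1, map_mul]
    rfl
  · rw [T.joinOp_image, if_neg (hins.not.2 hU), T.joinOp_image]
    split_ifs with h1 h2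
    · exact absurd ⟨h2, h1⟩ hU
    · simp
    · rfl

theorem joinOp_empty (T : GammaFamily Γ H) : T.joinOp ∅ = 1 := by
  rw [T.joinOp_of_isJoin (r := 1) fun x => by simp, map_one]

theorem restrict_joinOp_image (T : GammaFamily Γ H) (S : Set V) (U : Finset S) :
    (T.restrict S).joinOp (U.image (gen (Γ.induce S))) =
      T.joinOp ((U.image Subtype.val).image (gen Γ)) := by
  by_cases hU : (Γ.induce S).IsClique (U : Set S)
  · have hp : (U.toList.map Subtype.val).Pairwise Γ.Adj :=
      (pairwise_toList hU).map _ fun _ _ h => h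
    have hj : IsJoin ((U.image Subtype.val).image (gen Γ))
        ((U.toList.map Subtype.val).map (gen Γ)).prod := by
      intro x
      rw [← forall_gen_dvd_iff hp, Finset.forall_mem_image]
      simp
    rw [joinOp_image, if_pos hU, T.joinOp_of_isJoin hj, cliqueProd, map_list_prod, map_list_prod,
      List.map_map, List.map_map, List.map_map]
    rfl
  · have hU' : ¬ Γ.IsClique ((U.image Subtype.val : Finset V) : Set V) := by
      refine fun h => hU fun i hi j hj hij => ?_
      exact h (by simpa using hi) (by simpa using hj) (Subtype.coe_injective.ne hij)
    rw [joinOp_image, if_neg hU, joinOp_image, if_neg hU']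

variable [CompleteSpace H]

/-! ### Positivity of `Z` on arbitrary sets of generators -/

theorem Z_empty (T : GammaFamily Γ H) : T.Z ∅ = 1 := by
  simp [Z, joinOp_empty]

theorem Z_image (T : GammaFamily Γ H) (S : Finset V) :
    T.Z (S.image (gen Γ)) = ∑ U ∈ S.powerset, (-1 : ℂ) ^ U.card •
      (T.joinOp (U.image (gen Γ)) * star (T.joinOp (U.image (gen Γ)))) := by
  rw [Z, Finset.powerset_image, Finset.sum_image]
  · exact Finset.sum_congr rfl fun U _ => by
      rw [Finset.card_image_of_injective _ gen_injective]
  · exact (Finset.image_injective gen_injective).injOn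

/-- A subset containing `i` has a join only if its other elements are neighbours of `i`; then `T_i`
factors out on both sides and the sign flips. -/
theorem Z_image_insert (T : GammaFamily Γ H) {i : V} {S : Finset V} (hi : i ∉ S) :
    T.Z ((insert i S).image (gen Γ)) = T.Z (S.image (gen Γ)) -
      T.op i * T.Z ((S.filter (Γ.Adj i)).image (gen Γ)) * star (T.op i) := by
  simp only [Z_image]
  rw [Finset.sum_powerset_insert hi, sub_eq_add_neg]
  congr 1
  have hsub : (S.filter (Γ.Adj i)).powerset ⊆ S.powerset :=
    Finset.powerset_mono.2 (Finset.filter_subset _ _)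
  rw [Finset.mul_sum, Finset.sum_mul, ← Finset.sum_neg_distrib, ← Finset.sum_subset hsub]
  · refine Finset.sum_congr rfl fun U hU => ?_
    rw [Finset.mem_powerset] at hU
    have hiU : i ∉ U := fun h => hi (Finset.mem_filter.1 (hU h)).1
    rw [T.joinOp_image_insert hiU, if_pos, Finset.card_insert_of_notMem hiU, star_mul, pow_succ]
    · simp only [mul_neg, mul_one, neg_smul, mul_smul_comm, smul_mul_assoc, mul_assoc]
    · exact fun j hj => (Finset.mem_filter.1 (hU hj)).2
  · intro U hU hU'
    rw [Finset.mem_powerset] at hU hU'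
    rw [T.joinOp_image_insert fun h => hi (hU h), if_neg]
    · simp
    · exact fun h => hU' fun j hj => Finset.mem_filter.2 ⟨hU hj, h j hj⟩

theorem gens_eq_image [Fintype V] (S : Set V) :
    gens Γ S = (Finset.univ.filter (· ∈ S)).image (gen Γ) := by
  ext x
  simp [gens]

/-- Brehmer's condition implies the positivity of `Z` on every set of generators. -/
theorem Brehmer.Z_nonneg [Finite V] {T : GammaFamily Γ H} (hT : T.Brehmer) (S : Finset V) :
    0 ≤ T.Z (S.image (gen Γ)) := by
  cases nonempty_fintype V
  -- Double downward induction, on the clique `W` and then on `S ⊆ N(W)`. For `S = N(W)` this is the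
  -- hypothesis. Otherwise pick `i ∈ N(W) \ S` and use `Z(S) = Z(S ∪ {i}) + T_i Z(S ∩ N(i)) T_i^*`:
  -- the first set is larger, the second lies in `N(W ∪ {i})`.
  suffices key : ∀ n : ℕ, ∀ W : Finset V, Fintype.card V - W.card = n →
      Γ.IsClique (W : Set V) → ∀ k : ℕ, ∀ S : Finset V, (∀ i ∈ S, ∀ j ∈ W, Γ.Adj i j) →
        Fintype.card V - S.card = k → 0 ≤ T.Z (S.image (gen Γ)) from
    key _ ∅ rfl (by simp) _ S (by simp) rfl
  intro n
  induction n using Nat.strong_induction_on with | _ n ihn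
  intro W hWn hW k
  induction k using Nat.strong_induction_on with | _ k ihk
  intro S hS hSk
  by_cases hN : ∀ i, (∀ j ∈ W, Γ.Adj i j) → i ∈ S
  · have := hT W hW
    rw [gens_eq_image] at this
    convert this using 3
    ext i
    simpa using ⟨hS i, hN i⟩
  · push Not at hN
    obtain ⟨i, hiW, hiS⟩ := hN
    have h1 : 0 ≤ T.Z ((insert i S).image (gen Γ)) := by
      have hc : (insert i S).card ≤ Fintype.card V := Finset.card_le_univ _
      refine ihk (Fintype.card V - (insert i S).card) ?_ _ ?_ rfl
      · rw [Finset.card_insert_of_notMem hiS] at hc ⊢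
        omega
      · exact fun a ha => (Finset.mem_insert.1 ha).elim (fun h => h ▸ hiW) (hS a)
    have h2 : 0 ≤ T.Z ((S.filter (Γ.Adj i)).image (gen Γ)) := by
      have hi : i ∉ W := fun h => Γ.loopless.irrefl i (hiW i h)
      have hc : (insert i W).card ≤ Fintype.card V := Finset.card_le_univ _
      refine ihn (Fintype.card V - (insert i W).card) ?_ (insert i W) rfl ?_ _ _ ?_ rfl
      · rw [Finset.card_insert_of_notMem hi] at hc ⊢
        omega
      · rw [Finset.coe_insert]
        exact hW.insert fun j hj _ => hiW j hj
      · intro a ha j hj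
        rw [Finset.mem_filter] at ha
        exact (Finset.mem_insert.1 hj).elim (fun h => h ▸ ha.2.symm) (hS a ha.1 j)
    have h3 := T.Z_image_insert hiS
    rw [eq_sub_iff_add_eq] at h3
    rw [← h3]
    exact add_nonneg h1 (star_right_conjugate_nonneg h2 _)

theorem restrict_Z_image (T : GammaFamily Γ H) (S : Set V) (U : Finset S) :
    (T.restrict S).Z (U.image (gen (Γ.induce S))) =
      T.Z ((U.image Subtype.val).image (gen Γ)) := by
  rw [Z_image, Z_image, Finset.powerset_image, Finset.sum_image]
  · exact Finset.sum_congr rfl fun W _ => by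
      rw [Finset.card_image_of_injective _ Subtype.coe_injective, restrict_joinOp_image]
  · exact (Finset.image_injective Subtype.coe_injective).injOn

theorem WeakBrehmer.Z_nonneg [Finite V] {T : GammaFamily Γ H} (hT : T.WeakBrehmer)
    (c : Γᶜ.ConnectedComponent) {S : Finset V} (hS : (S : Set V) ⊆ c.supp) :
    0 ≤ T.Z (S.image (gen Γ)) := by
  have h := (hT c).Z_nonneg (S.preimage Subtype.val Subtype.coe_injective.injOn)
  rw [restrict_Z_image] at h
  convert h using 3
  ext i
  simpa using fun hi => hS hi

end GammaFamily

/-! ### Factorization along commuting sets of letters -/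

namespace RAAM

variable {V : Type*} {Γ : SimpleGraph V}

theorem gen_mul_comm_of_adj {i : V} {p : RAAM Γ} (h : ∀ j, count p j ≠ 0 → Γ.Adj j i) :
    gen Γ i * p = p * gen Γ i := by
  induction p using induction_gen_mul with
  | one => simp
  | gen_mul j p ih =>
    rw [mul_assoc, ← ih fun k hk => h k (by simp [hk]), ← mul_assoc, ← mul_assoc,
      gen_comm (h j (by simp))]

/-- Factorization of an element along two commuting sets of generators. -/
theorem exists_mul_eq_of_adj {A B : Set V} (hAB : ∀ i ∈ A, ∀ j ∈ B, Γ.Adj i j) (p : RAAM Γ)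
    (hp : ∀ i, count p i ≠ 0 → i ∈ A ∨ i ∈ B) :
    ∃ a b, a * b = p ∧ count a = A.indicator (count p) ∧ count b = Aᶜ.indicator (count p) := by
  induction p using induction_gen_mul with
  | one => exact ⟨1, 1, by simp⟩
  | gen_mul i p ih =>
    obtain ⟨a, b, hab, ha, hb⟩ := ih fun k hk => hp k (by simp [hk])
    by_cases hi : i ∈ A
    · refine ⟨gen Γ i * a, b, by rw [mul_assoc, hab], ?_, ?_⟩
      · ext k
        by_cases hk : k ∈ A <;> simp [ha, hk, Pi.single_apply]
        rintro rfl
        exact hk hi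
      · ext k
        by_cases hk : k ∈ A <;> simp [hb, hk, Pi.single_apply]
        rintro rfl
        exact hk hi
    · have hiB : i ∈ B := (hp i (by simp)).resolve_left hi
      refine ⟨a, gen Γ i * b, ?_, ?_, ?_⟩
      · rw [← hab, ← mul_assoc, ← mul_assoc, gen_mul_comm_of_adj]
        intro j hj
        rw [ha] at hj
        exact hAB j (Set.mem_of_indicator_ne_zero hj) i hiB
      · ext k
        by_cases hk : k ∈ A <;> simp [ha, hk, Pi.single_apply]
        rintro rfl
        exact hi hk
      · ext k
        by_cases hk : k ∈ A <;> simp [hb, hk, Pi.single_apply]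
        rintro rfl
        exact hi hk

theorem adj_of_component_ne {i j : V}
    (h : Γᶜ.connectedComponentMk i ≠ Γᶜ.connectedComponentMk j) : Γ.Adj i j := by
  by_contra hij
  have hne : i ≠ j := fun e => h (by rw [e])
  refine h (SimpleGraph.ConnectedComponent.sound (SimpleGraph.Adj.reachable ?_))
  exact (SimpleGraph.compl_adj _ _ _).2 ⟨hne, hij⟩

end RAAM

/-! ### Square-sum estimates in a fixed multidegree -/

namespace GammaFamily

open RAAM

variable {V : Type*} {Γ : SimpleGraph V} {H : Type*} [NormedAddCommGroup H]
  [InnerProductSpace ℂ H]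

theorem re_inner_nonneg {A : H →L[ℂ] H} (hA : 0 ≤ A) (h : H) : 0 ≤ (inner ℂ (A h) h).re :=
  ((ContinuousLinearMap.nonneg_iff_isPositive A).1 hA).re_inner_nonneg_left h

variable [CompleteSpace H]

theorem star_rep_mul_apply (T : GammaFamily Γ H) (p q : RAAM Γ) (h : H) :
    star (T.rep (p * q)) h = star (T.rep q) (star (T.rep p) h) := by
  rw [map_mul, star_mul]
  rfl

theorem re_inner_mul_star (A : H →L[ℂ] H) (h : H) :
    (inner ℂ ((A * star A) h) h).re = ‖star A h‖ ^ 2 := by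
  rw [mul_apply_eq_comp, ← ContinuousLinearMap.adjoint_inner_right,
    ← ContinuousLinearMap.star_eq_adjoint, inner_self_eq_norm_sq_to_K]
  norm_cast

theorem re_inner_Z_image [Fintype V] (T : GammaFamily Γ H) (S : Finset V) (h : H) :
    (inner ℂ (T.Z (S.image (gen Γ)) h) h).re =
      ∑ U ∈ cliques Γ, if U ⊆ S then
        (-1 : ℝ) ^ U.card * ‖star (T.rep (cliqueProd Γ U)) h‖ ^ 2 else 0 := by
  rw [T.Z_image, ← Finset.sum_filter, sum_apply, sum_inner, Complex.re_sum]
  have : (cliques Γ).filter (· ⊆ S) =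
      S.powerset.filter fun U : Finset V => Γ.IsClique (U : Set V) := by
    ext U
    simp [cliques, and_comm]
  rw [this, Finset.sum_filter]
  refine Finset.sum_congr rfl fun U _ => ?_
  rw [joinOp_image]
  split_ifs with hU
  · rw [smul_apply, inner_smul_left, map_pow, map_neg, map_one,
      ← re_inner_mul_star]
    have : ((-1 : ℂ) ^ U.card) = (((-1 : ℝ) ^ U.card : ℝ) : ℂ) := by norm_num
    rw [this, Complex.re_ofReal_mul]
  · simp

theorem defect_eq [Fintype V] (T : GammaFamily Γ H) (r : ℝ) :
    T.defect r = ∑ U ∈ cliques Γ, ((-1 : ℂ) ^ U.card * (r : ℂ) ^ (2 * U.card)) •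
      (T.rep (cliqueProd Γ U) * star (T.rep (cliqueProd Γ U))) := by
  rw [defect, gens_eq_image, Finset.powerset_image, Finset.sum_image, cliques, Finset.sum_filter]
  · simp only [Set.mem_univ, Finset.filter_true, Finset.powerset_univ]
    refine Finset.sum_congr rfl fun U _ => ?_
    rw [Finset.card_image_of_injective _ gen_injective, joinOp_image]
    split_ifs <;> simp
  · exact (Finset.image_injective gen_injective).injOn

/-- Distinct elements with the same letter counts behave as if `T_p T_p^*` had orthogonal ranges. -/
theorem sum_norm_sq_le_of_Z_nonneg [Finite V] (T : GammaFamily Γ H) (m : V → ℕ)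
    (hm : ∀ S : Finset V, (∀ i ∈ S, m i ≠ 0) → 0 ≤ T.Z (S.image (gen Γ)))
    (F : Finset (RAAM Γ)) (hF : ∀ p ∈ F, count p = m) (h : H) :
    ∑ p ∈ F, ‖star (T.rep p) h‖ ^ 2 ≤ ‖h‖ ^ 2 := by
  cases nonempty_fintype V
  -- The truncation gives finite support, hence summability, and turns the sum over all cliques at
  -- `p` into a sum over cliques inside `S p`.
  let g : RAAM Γ → ℝ := fun q => if count q ≤ m then ‖star (T.rep q) h‖ ^ 2 else 0
  have hg : Summable g := by
    refine summable_of_hasFiniteSupport ((finite_count_le m).subset fun q hq => ?_)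
    by_contra hn
    exact hq (if_neg hn)
  let S : RAAM Γ → Finset V := fun p => Finset.univ.filter fun i => count p i < m i
  have hkey : ∀ p, (∑ U ∈ cliques Γ, (-1 : ℝ) ^ U.card * g (p * cliqueProd Γ U)) =
      if count p ≤ m then
        (inner ℂ (T.Z ((S p).image (gen Γ)) (star (T.rep p) h)) (star (T.rep p) h)).re
      else 0 := by
    intro p
    have hle : ∀ U : Finset V, count (p * cliqueProd Γ U) ≤ m ↔ count p ≤ m ∧ U ⊆ S p := by
      intro U
      simp only [Pi.le_def, count_mul, Pi.add_apply, count_cliqueProd, Finset.subset_iff, S,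
        Finset.mem_filter, Finset.mem_univ, true_and]
      constructor
      · refine fun hU => ⟨fun i => le_trans (Nat.le_add_right _ _) (hU i), fun i hi => ?_⟩
        have := hU i
        rw [if_pos hi] at this
        omega
      · rintro ⟨h1, h2⟩ i
        split_ifs with hi
        · exact h2 hi
        · exact h1 i
    split_ifs with hp
    · rw [re_inner_Z_image]
      refine Finset.sum_congr rfl fun U _ => ?_
      simp only [g, hle, hp, true_and, star_rep_mul_apply]
      split_ifs <;> simp
    · refine Finset.sum_eq_zero fun U _ => ?_
      simp only [g, hle, hp, false_and, if_false, mul_zero]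
  have hsum := hasSum_sum_cliques hg
  have hg1 : g 1 = ‖h‖ ^ 2 := by
    have : (0 : V → ℕ) ≤ m := fun i => Nat.zero_le _
    simp [g, this]
  simp_rw [hkey] at hsum
  rw [hg1] at hsum
  refine le_trans (le_of_eq (Finset.sum_congr rfl fun p hp => ?_))
    (sum_le_hasSum F (fun p _ => ?_) hsum)
  · have hS : S p = ∅ := by simp [S, hF p hp]
    rw [if_pos (hF p hp).le, hS, Finset.image_empty, Z_empty, one_apply_eq_self, inner_self_eq_norm_sq_to_K]
    norm_cast
  · split_ifs
    · refine re_inner_nonneg (hm _ fun i hi => ?_) _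
      have := (Finset.mem_filter.1 hi).2
      omega
    · exact le_rfl

/-- Induction on the set of components of `Γᶜ` that meet the support of `m`. Splitting off a
component `c` writes `p = a b` with `b` in the letters of `c`; the single-component bound at `T_a^*
h` absorbs the sum over `b`, and induction handles the sum over `a`. -/
theorem WeakBrehmer.sum_norm_sq_le [Finite V] {T : GammaFamily Γ H} (hT : T.WeakBrehmer)
    (m : V → ℕ) (F : Finset (RAAM Γ)) (hF : ∀ p ∈ F, count p = m) (h : H) :
    ∑ p ∈ F, ‖star (T.rep p) h‖ ^ 2 ≤ ‖h‖ ^ 2 := by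
  cases nonempty_fintype V
  suffices key : ∀ (K : Finset Γᶜ.ConnectedComponent) (m : V → ℕ),
      (∀ i, m i ≠ 0 → Γᶜ.connectedComponentMk i ∈ K) →
      ∀ (F : Finset (RAAM Γ)), (∀ p ∈ F, count p = m) → ∀ h : H,
        ∑ p ∈ F, ‖star (T.rep p) h‖ ^ 2 ≤ ‖h‖ ^ 2 from
    key (Finset.univ.image Γᶜ.connectedComponentMk) m
      (fun i _ => Finset.mem_image_of_mem _ (Finset.mem_univ i)) F hF h
  clear F hF h m
  intro K
  induction K using Finset.induction_on with
  | empty =>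
    intro m hm F hF h
    have hm0 : m = 0 := by
      ext i
      by_contra hi
      simpa using hm i hi
    exact T.sum_norm_sq_le_of_Z_nonneg m (fun S hS => by
      have : S = ∅ := Finset.eq_empty_of_forall_notMem fun i hi => hS i hi (by simp [hm0])
      subst this
      rw [Finset.image_empty, Z_empty]
      exact zero_le_one) F hF h
  | insert c K hc ih =>
    intro m hm F hF h
    let A : Set V := {i | Γᶜ.connectedComponentMk i ∈ K}
    have hAc : ∀ i ∈ A, ∀ j ∈ c.supp, Γ.Adj i j := by
      intro i hi j hj
      refine adj_of_component_ne fun e => hc ?_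
      rw [← SimpleGraph.ConnectedComponent.mem_supp_iff c j |>.1 hj, ← e]
      exact hi
    have hfac : ∀ p : RAAM Γ, ∃ a b, p ∈ F →
        a * b = p ∧ count a = A.indicator m ∧ count b = Aᶜ.indicator m := by
      intro p
      by_cases hp : p ∈ F
      · obtain ⟨a, b, hab⟩ := exists_mul_eq_of_adj hAc p (by
          intro i hi
          rw [hF p hp] at hi
          exact (Finset.mem_insert.1 (hm i hi)).elim (fun e => Or.inr e) Or.inl)
        rw [hF p hp] at hab
        exact ⟨a, b, fun _ => hab⟩
      · exact ⟨1, 1, fun h => absurd h hp⟩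
    choose a b hab using hfac
    have hinj : Set.InjOn (fun p => (a p, b p)) (F : Set (RAAM Γ)) := by
      intro p hp q hq hpq
      rw [Prod.mk.injEq] at hpq
      rw [← (hab p hp).1, ← (hab q hq).1, hpq.1, hpq.2]
    -- Enlarging to the full product only adds nonnegative terms and makes the sum iterated.
    have hsub : F.image (fun p => (a p, b p)) ⊆ F.image a ×ˢ F.image b := by
      intro x hx
      obtain ⟨p, hp, rfl⟩ := Finset.mem_image.1 hx
      exact Finset.mem_product.2 ⟨Finset.mem_image_of_mem a hp, Finset.mem_image_of_mem b hp⟩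
    calc ∑ p ∈ F, ‖star (T.rep p) h‖ ^ 2
        = ∑ x ∈ F.image (fun p => (a p, b p)),
            ‖star (T.rep x.2) (star (T.rep x.1) h)‖ ^ 2 := by
          rw [Finset.sum_image hinj]
          refine Finset.sum_congr rfl fun p hp => ?_
          rw [← star_rep_mul_apply, (hab p hp).1]
      _ ≤ ∑ x ∈ F.image a ×ˢ F.image b, ‖star (T.rep x.2) (star (T.rep x.1) h)‖ ^ 2 :=
          Finset.sum_le_sum_of_subset_of_nonneg hsub fun _ _ _ => by positivity
      _ = ∑ x ∈ F.image a, ∑ y ∈ F.image b, ‖star (T.rep y) (star (T.rep x) h)‖ ^ 2 :=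
          Finset.sum_product _ _ _
      _ ≤ ∑ x ∈ F.image a, ‖star (T.rep x) h‖ ^ 2 := by
          refine Finset.sum_le_sum fun x _ => ?_
          refine T.sum_norm_sq_le_of_Z_nonneg (Aᶜ.indicator m)
            (fun S hS => hT.Z_nonneg c fun i hi => ?_) _ (fun y hy => ?_) _
          · have hi' := hS i hi
            have hiA : i ∈ Aᶜ := Set.mem_of_indicator_ne_zero hi'
            rw [Set.indicator_of_mem hiA] at hi'
            exact (Finset.mem_insert.1 (hm i hi')).resolve_right hiA
          · obtain ⟨p, hp, rfl⟩ := Finset.mem_image.1 hy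
            exact (hab p hp).2.2
      _ ≤ ‖h‖ ^ 2 := by
          refine ih (A.indicator m) (fun i hi => ?_) _ (fun x hx => ?_) h
          · have : i ∈ A := Set.mem_of_indicator_ne_zero hi
            exact this
          · obtain ⟨p, hp, rfl⟩ := Finset.mem_image.1 hx
            exact (hab p hp).2.1

/-- The weight depends only on the multidegree, so each fibre of `count` costs at most `∏ x^{m i}
‖h‖²`. Summing over a box of multidegrees gives a product of partial geometric sums, one per vertex.
-/
theorem WeakBrehmer.sum_pow_mul_norm_sq_le [Fintype V] {T : GammaFamily Γ H}
    (hT : T.WeakBrehmer) {x : ℝ} (hx0 : 0 ≤ x) (hx1 : x < 1) (F : Finset (RAAM Γ)) (h : H) :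
    ∑ p ∈ F, x ^ length Γ p * ‖star (T.rep p) h‖ ^ 2 ≤
      ((1 - x)⁻¹) ^ Fintype.card V * ‖h‖ ^ 2 := by
  let N := F.sup (length Γ) + 1
  have hsub : F.image count ⊆ Fintype.piFinset fun _ : V => Finset.range N := by
    intro m hm
    obtain ⟨p, hp, rfl⟩ := Finset.mem_image.1 hm
    rw [Fintype.mem_piFinset]
    intro i
    rw [Finset.mem_range, Nat.lt_succ_iff]
    refine le_trans ?_ (Finset.le_sup (f := length Γ) hp)
    rw [← sum_count p]
    exact Finset.single_le_sum (fun i _ => Nat.zero_le (count p i)) (Finset.mem_univ i)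
  calc ∑ p ∈ F, x ^ length Γ p * ‖star (T.rep p) h‖ ^ 2
      = ∑ m ∈ F.image count, ∑ p ∈ F.filter (count · = m),
          x ^ length Γ p * ‖star (T.rep p) h‖ ^ 2 :=
        (Finset.sum_fiberwise_of_maps_to (fun p hp => Finset.mem_image_of_mem _ hp) _).symm
    _ ≤ ∑ m ∈ F.image count, (∏ i, x ^ m i) * ‖h‖ ^ 2 := by
        refine Finset.sum_le_sum fun m _ => ?_
        have : ∑ p ∈ F.filter (count · = m), x ^ length Γ p * ‖star (T.rep p) h‖ ^ 2 =
            (∏ i, x ^ m i) * ∑ p ∈ F.filter (count · = m), ‖star (T.rep p) h‖ ^ 2 := by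
          rw [Finset.mul_sum]
          refine Finset.sum_congr rfl fun p hp => ?_
          rw [← sum_count, (Finset.mem_filter.1 hp).2, Finset.prod_pow_eq_pow_sum]
        rw [this]
        exact mul_le_mul_of_nonneg_left
          (hT.sum_norm_sq_le m _ (fun p hp => (Finset.mem_filter.1 hp).2) h) (by positivity)
    _ = (∑ m ∈ F.image count, ∏ i, x ^ m i) * ‖h‖ ^ 2 := by rw [Finset.sum_mul]
    _ ≤ ((1 - x)⁻¹) ^ Fintype.card V * ‖h‖ ^ 2 := by
        refine mul_le_mul_of_nonneg_right ?_ (by positivity)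
        calc ∑ m ∈ F.image count, ∏ i, x ^ m i
            ≤ ∑ m ∈ Fintype.piFinset fun _ : V => Finset.range N, ∏ i, x ^ m i :=
              Finset.sum_le_sum_of_subset_of_nonneg hsub fun _ _ _ => by positivity
          _ = ∏ _i : V, ∑ k ∈ Finset.range N, x ^ k :=
              (Finset.prod_univ_sum (fun _ : V => Finset.range N) fun _ k => x ^ k).symm
          _ ≤ ∏ _i : V, (1 - x)⁻¹ := by
              refine Finset.prod_le_prod (fun _ _ => by positivity) fun _ _ => ?_
              rw [← tsum_geometric_of_lt_one hx0 hx1]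
              exact (summable_geometric_of_lt_one hx0 hx1).sum_le_tsum _ fun _ _ => by positivity
          _ = ((1 - x)⁻¹) ^ Fintype.card V := by simp

end GammaFamily

/-! ### Hilbert tensor products -/

section Tensor

variable {E F G : Type*} [NormedAddCommGroup E] [InnerProductSpace ℂ E]
  [NormedAddCommGroup F] [InnerProductSpace ℂ F] [NormedAddCommGroup G] [NormedSpace ℂ G]

theorem inner_hTmul (x x' : E) (y y' : F) :
    inner ℂ (hTmul x y) (hTmul x' y') = inner ℂ x x' * inner ℂ y y' := by
  simp [hTmul, UniformSpace.Completion.inner_coe]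

theorem hilbertTensor_ext {A B : HilbertTensor E F →L[ℂ] G}
    (h : ∀ x y, A (hTmul x y) = B (hTmul x y)) : A = B := by
  ext z
  induction z using UniformSpace.Completion.induction_on with
  | hp => exact isClosed_eq A.continuous B.continuous
  | ih z =>
    induction z using TensorProduct.induction_on with
    | zero => rw [UniformSpace.Completion.coe_zero, map_zero, map_zero]
    | tmul x y => exact h x y
    | add z w hz hw =>
      rw [UniformSpace.Completion.coe_add, map_add, map_add, hz, hw]

theorem hTmul_add_left (x x' : E) (y : F) : hTmul (x + x') y = hTmul x y + hTmul x' y := by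
  simp only [hTmul, TensorProduct.add_tmul, UniformSpace.Completion.coe_add]

theorem hTmul_add_right (x : E) (y y' : F) : hTmul x (y + y') = hTmul x y + hTmul x y' := by
  simp only [hTmul, TensorProduct.tmul_add, UniformSpace.Completion.coe_add]

theorem hTmul_smul_left (c : ℂ) (x : E) (y : F) : hTmul (c • x) y = c • hTmul x y := by
  simp only [hTmul, ← TensorProduct.smul_tmul', UniformSpace.Completion.coe_smul]

theorem hTmul_smul_right (c : ℂ) (x : E) (y : F) : hTmul x (c • y) = c • hTmul x y := by
  simp only [hTmul, TensorProduct.tmul_smul, UniformSpace.Completion.coe_smul]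

theorem hTmul_zero_left (y : F) : hTmul (0 : E) y = 0 := by
  simp [hTmul]

theorem adjoint_hTensorOp [CompleteSpace E] [CompleteSpace F] (a : E →L[ℂ] E) (b : F →L[ℂ] F) :
    star (hTensorOp a b) = hTensorOp (star a) (star b) := by
  refine hilbertTensor_ext fun x y => ?_
  refine ext_inner_left ℂ fun v => ?_
  rw [ContinuousLinearMap.star_eq_adjoint, ContinuousLinearMap.adjoint_inner_right,
    hTensorOp_hTmul, ← inner_conj_symm, ← inner_conj_symm v]
  congr 1
  have : (innerSL ℂ (hTmul x y)).comp (hTensorOp a b) =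
      innerSL ℂ (hTmul (star a x) (star b y)) := by
    refine hilbertTensor_ext fun u w => ?_
    simp only [ContinuousLinearMap.comp_apply, innerSL_apply_apply, hTensorOp_hTmul, inner_hTmul,
      ContinuousLinearMap.star_eq_adjoint, ContinuousLinearMap.adjoint_inner_left]
  exact congrArg (fun f => f v) this

variable (E F) in
/-- The amplification `a ↦ a ⊗ I` as a `*`-homomorphism. -/
def hTensorAmplify [CompleteSpace E] [CompleteSpace F] :
    (E →L[ℂ] E) →⋆ₐ[ℂ] (HilbertTensor E F →L[ℂ] HilbertTensor E F) where
  toFun a := hTensorOp a 1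
  map_one' := hilbertTensor_ext fun x y => by simp [hTensorOp_hTmul]
  map_mul' a b := hilbertTensor_ext fun x y => by simp [hTensorOp_hTmul]
  map_zero' := hilbertTensor_ext fun x y => by simp [hTensorOp_hTmul, hTmul_zero_left]
  map_add' a b := hilbertTensor_ext fun x y => by simp [hTensorOp_hTmul, hTmul_add_left]
  commutes' c := hilbertTensor_ext fun x y => by
    simp [hTensorOp_hTmul, Algebra.algebraMap_eq_smul_one, hTmul_smul_left]
  map_star' a := by rw [adjoint_hTensorOp, star_one]

theorem hTensorAmplify_apply [CompleteSpace E] [CompleteSpace F] (a : E →L[ℂ] E) :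
    hTensorAmplify E F a = hTensorOp a 1 := rfl

theorem hTensorOp_comm (a : E →L[ℂ] E) (b : F →L[ℂ] F) :
    (hTensorOp a 1).comp (hTensorOp 1 b) = (hTensorOp 1 b).comp (hTensorOp a 1) :=
  hilbertTensor_ext fun x y => by simp [hTensorOp_hTmul]

/-- The isometry `y ↦ x ⊗ y` for a unit vector `x`. -/
def hTmulIsometry (x : E) (hx : ‖x‖ = 1) : F →ₗᵢ[ℂ] HilbertTensor E F where
  toFun := hTmul x
  map_add' := hTmul_add_right x
  map_smul' c y := hTmul_smul_right c x y
  norm_map' y := by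
    change ‖((x ⊗ₜ[ℂ] y : E ⊗[ℂ] F) : HilbertTensor E F)‖ = ‖y‖
    rw [UniformSpace.Completion.norm_coe, TensorProduct.norm_tmul, hx, one_mul]

theorem orthogonalFamily_hTmul {ι : Type*} {e : ι → E} (he : Orthonormal ℂ e) :
    OrthogonalFamily ℂ (fun _ : ι => F) fun i => hTmulIsometry (F := F) (e i) (he.1 i) := by
  intro i j hij x y
  change inner ℂ (hTmul (e i) x) (hTmul (e j) y) = 0
  rw [inner_hTmul, he.2 hij, zero_mul]

end Tensor

theorem OrthogonalFamily.hasSum_norm_sq {ι E : Type*} {G : ι → Type*} [NormedAddCommGroup E]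
    [InnerProductSpace ℂ E] [∀ i, NormedAddCommGroup (G i)] [∀ i, InnerProductSpace ℂ (G i)]
    {V : ∀ i, G i →ₗᵢ[ℂ] E} (hV : OrthogonalFamily ℂ G V) {f : ∀ i, G i} {x : E}
    (hf : HasSum (fun i => V i (f i)) x) : HasSum (fun i => ‖f i‖ ^ 2) (‖x‖ ^ 2) := by
  have : Filter.Tendsto (fun s : Finset ι => ‖∑ i ∈ s, V i (f i)‖ ^ 2) Filter.atTop
      (nhds (‖x‖ ^ 2)) := (Filter.Tendsto.norm hf).pow 2
  simp only [hV.norm_sum] at this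
  exact this

/-! ### Adjoints of the left regular representation -/

theorem inner_ell2Basis_left {P : Type*} (p : P) (f : ELL2 P) :
    inner ℂ (ell2Basis p) f = f p := by
  rw [ell2Basis, lp.inner_single_left]
  simp

theorem inner_ell2Basis {P : Type*} (p q : P) :
    inner ℂ (ell2Basis p) (ell2Basis q : ELL2 P) = if p = q then 1 else 0 :=
  orthonormal_iff_ite.1 (orthonormal_ell2Basis P) p q

theorem ell2_ext {P G : Type*} [NormedAddCommGroup G] [NormedSpace ℂ G]
    {A B : ELL2 P →L[ℂ] G} (h : ∀ p, A (ell2Basis p) = B (ell2Basis p)) : A = B := by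
  ext f
  have hf := lp.hasSum_single (by norm_num : (2 : ENNReal) ≠ ⊤) f
  have e : ∀ p, lp.single 2 p (f p) = f p • (ell2Basis p : ELL2 P) := fun p => by
    rw [ell2Basis, ← lp.single_smul, smul_eq_mul, mul_one]
  have hA := hf.mapL A
  have hB := hf.mapL B
  simp only [e, map_smul, h] at hA hB
  exact hA.unique hB

section Regular

variable {P : Type*} [Monoid P] [IsLeftCancelMul P]

theorem star_leftRegular_apply (p q y : P) :
    star (leftRegular p) (ell2Basis q) y = if p * y = q then 1 else 0 := by
  rw [← inner_ell2Basis_left, ContinuousLinearMap.star_eq_adjoint,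
    ContinuousLinearMap.adjoint_inner_right, leftRegular_ell2Basis, inner_ell2Basis]

theorem star_leftRegular_mul (p q : P) :
    star (leftRegular p) (ell2Basis (p * q)) = ell2Basis q := by
  ext y
  rw [star_leftRegular_apply, ← inner_ell2Basis_left, inner_ell2Basis, mul_right_inj]

theorem star_leftRegular_of_not_dvd {p q : P} (h : ¬ p ∣ q) :
    star (leftRegular p) (ell2Basis q) = 0 := by
  ext y
  rw [star_leftRegular_apply, if_neg fun e => h ⟨y, e.symm⟩]
  rfl

theorem leftRegular_one : leftRegular (1 : P) = 1 :=
  ell2_ext fun p => by rw [leftRegular_ell2Basis, one_mul]; rfl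

theorem leftRegular_mul (p q : P) : leftRegular (p * q) = leftRegular p * leftRegular q :=
  ell2_ext fun x => by
    rw [mul_apply_eq_comp, leftRegular_ell2Basis, leftRegular_ell2Basis, leftRegular_ell2Basis,
      mul_assoc]

theorem star_leftRegular_mul_self (p : P) : star (leftRegular p) * leftRegular p = 1 :=
  ell2_ext fun x => by
    rw [mul_apply_eq_comp, leftRegular_ell2Basis, star_leftRegular_mul]
    rfl

end Regular

namespace GammaFamily

open RAAM

variable {V : Type*} {Γ : SimpleGraph V} {H : Type*} [NormedAddCommGroup H]
  [InnerProductSpace ℂ H]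

/-! ### The Cauchy transform -/

theorem norm_smul_sq (r : ℝ) (n : ℕ) (h : H) :
    ‖((r : ℂ) ^ n) • h‖ ^ 2 = (r ^ 2) ^ n * ‖h‖ ^ 2 := by
  rw [norm_smul, norm_pow, Complex.norm_real, mul_pow, ← pow_mul, mul_comm n, pow_mul,
    Real.norm_eq_abs, sq_abs]

variable [CompleteSpace H]

theorem sq_lt_one_of_nonneg {r : ℝ} (h0 : 0 ≤ r) (h1 : r < 1) : r ^ 2 < 1 := by nlinarith

theorem WeakBrehmer.summable [Finite V] {T : GammaFamily Γ H} (hT : T.WeakBrehmer) {r : ℝ}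
    (h0 : 0 ≤ r) (h1 : r < 1) (h : H) :
    Summable fun p : RAAM Γ => (r ^ 2) ^ length Γ p * ‖star (T.rep p) h‖ ^ 2 := by
  cases nonempty_fintype V
  exact summable_of_sum_le (fun _ => by positivity) fun F =>
    hT.sum_pow_mul_norm_sq_le (sq_nonneg r) (sq_lt_one_of_nonneg h0 h1) F h

/-- The subspaces `e_p ⊗ H` are mutually orthogonal, so convergence and the norm bound both reduce
to the square-sum estimate at `x = r²`. -/
theorem WeakBrehmer.exists_isCauchyTransform [Finite V] {T : GammaFamily Γ H}
    (hT : T.WeakBrehmer) {r : ℝ} (h0 : 0 ≤ r) (h1 : r < 1) :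
    ∃ C, T.IsCauchyTransform r C := by
  cases nonempty_fintype V
  have hV := orthogonalFamily_hTmul (F := H) (orthonormal_ell2Basis (RAAM Γ))
  let f : H → RAAM Γ → HilbertTensor (ELL2 (RAAM Γ)) H := fun h p =>
    hTmul (ell2Basis p) (((r : ℂ) ^ length Γ p) • (star (T.rep p)) h)
  have hs : ∀ h, Summable (f h) := by
    intro h
    refine (hV.summable_iff_norm_sq_summable _).2 ?_
    simp only [norm_smul_sq]
    exact hT.summable h0 h1 h
  let c : ℝ := ((1 - r ^ 2)⁻¹) ^ Fintype.card V
  have hb : ∀ h, ‖∑' p, f h p‖ ≤ √c * ‖h‖ := by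
    intro h
    have hc : 0 ≤ c := by
      have := sq_lt_one_of_nonneg h0 h1
      have : 0 ≤ (1 - r ^ 2)⁻¹ := inv_nonneg.2 (by linarith)
      positivity
    refine le_of_sq_le_sq ?_ (by positivity)
    rw [mul_pow, Real.sq_sqrt hc]
    refine hasSum_le_of_sum_le (hV.hasSum_norm_sq (hs h).hasSum) fun F => ?_
    simp only [norm_smul_sq]
    exact hT.sum_pow_mul_norm_sq_le (sq_nonneg r) (sq_lt_one_of_nonneg h0 h1) F h
  refine ⟨LinearMap.mkContinuous
    { toFun := fun h => ∑' p, f h p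
      map_add' := fun h k => ?_
      map_smul' := fun z h => ?_ } (√c) hb, fun h => (hs h).hasSum⟩
  · rw [← (hs h).tsum_add (hs k)]
    exact tsum_congr fun p => by simp only [f, map_add, smul_add, hTmul_add_right]
  · rw [RingHom.id_apply, ← (hs h).tsum_const_smul]
    exact tsum_congr fun p => by
      simp only [f, map_smul, hTmul_smul_right, smul_comm z]

theorem WeakBrehmer.isCauchyTransform [Finite V] {T : GammaFamily Γ H}
    (hT : T.WeakBrehmer) {r : ℝ} (h0 : 0 ≤ r) (h1 : r < 1) :
    T.IsCauchyTransform r (T.cauchyTransform r) := by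
  have h := hT.exists_isCauchyTransform h0 h1
  rw [cauchyTransform, dif_pos h]
  exact h.choose_spec

/-- `λ_q^*` kills `e_x` unless `x = q y`, so the series reindexes over `y`, and `r^{|qy|} T_{qy}^* =
r^{|q|} r^{|y|} T_y^* T_q^*`. -/
theorem IsCauchyTransform.star_leftRegular_apply {T : GammaFamily Γ H} {r : ℝ}
    {C : H →L[ℂ] HilbertTensor (ELL2 (RAAM Γ)) H} (hC : T.IsCauchyTransform r C)
    (q : RAAM Γ) :
    (hTensorOp (star (leftRegular q)) 1).comp C =
      ((r : ℂ) ^ length Γ q) • C.comp (star (T.rep q)) := by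
  ext h
  have h1 := (hC h).mapL (hTensorOp (star (leftRegular q)) 1)
  have hinj : Function.Injective (q * ·) := mul_right_injective q
  rw [← hinj.hasSum_iff] at h1
  · refine h1.unique ?_
    convert (hC (star (T.rep q) h)).const_smul ((r : ℂ) ^ length Γ q) using 2 with y
    · simp only [Function.comp_apply, hTensorOp_hTmul, star_leftRegular_mul, one_apply_eq_self]
      simp only [length_mul, star_rep_mul_apply, pow_add, mul_smul, hTmul_smul_right]
    · rfl
  · intro x hx
    rw [hTensorOp_hTmul, star_leftRegular_of_not_dvd, hTmul_zero_left]
    rintro ⟨y, rfl⟩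
    exact hx ⟨y, rfl⟩

/-! ### The Poisson kernel -/

theorem re_inner_defect [Fintype V] (T : GammaFamily Γ H) (r : ℝ) (h : H) :
    (inner ℂ (T.defect r h) h).re = ∑ U ∈ cliques Γ,
      (-1 : ℝ) ^ U.card * ((r ^ 2) ^ U.card * ‖star (T.rep (cliqueProd Γ U)) h‖ ^ 2) := by
  rw [defect_eq, sum_apply, sum_inner, Complex.re_sum]
  refine Finset.sum_congr rfl fun U _ => ?_
  have e : ((-1 : ℂ) ^ U.card * (r : ℂ) ^ (2 * U.card)) =
      (((-1 : ℝ) ^ U.card * (r ^ 2) ^ U.card : ℝ) : ℂ) := by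
    push_cast
    rw [pow_mul]
  rw [smul_apply, inner_smul_left, e, Complex.conj_ofReal, Complex.re_ofReal_mul,
    re_inner_mul_star, mul_assoc]

theorem norm_sqrt_apply_sq {A : H →L[ℂ] H} (hA : 0 ≤ A) (h : H) :
    ‖CFC.sqrt A h‖ ^ 2 = (inner ℂ (A h) h).re := by
  have hs : star (CFC.sqrt A) = CFC.sqrt A := (CFC.sqrt_nonneg A).isSelfAdjoint
  have := re_inner_mul_star (CFC.sqrt A) h
  rw [hs, CFC.sqrt_mul_sqrt_self A hA] at this
  exact this.symm

/-- The squared norm of the `p`-th component is `r^{2|p|} ⟨Δ_r T_p^* h, T_p^* h⟩`. Expanding `Δ_r`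
over cliques gives the Möbius sum of `q ↦ r^{2|q|} ‖T_q^* h‖²`, whose total is the value at `q = 1`.
-/
theorem WeakBrehmer.norm_poissonKernel_apply [Finite V] {T : GammaFamily Γ H}
    (hT : T.WeakBrehmer) {r : ℝ} (h0 : 0 ≤ r) (h1 : r < 1) (hr : 0 ≤ T.defect r) (h : H) :
    ‖T.poissonKernel r h‖ = ‖h‖ := by
  cases nonempty_fintype V
  have hV := orthogonalFamily_hTmul (F := H) (orthonormal_ell2Basis (RAAM Γ))
  have hK := (hT.isCauchyTransform h0 h1 h).mapL (hTensorOp 1 (CFC.sqrt (T.defect r)))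
  simp only [hTensorOp_hTmul, one_apply_eq_self] at hK
  have hK2 := hV.hasSum_norm_sq hK
  have hM := hasSum_sum_cliques (hT.summable h0 h1 h)
  have e : ∀ p : RAAM Γ,
      ‖CFC.sqrt (T.defect r) (((r : ℂ) ^ length Γ p) • (star (T.rep p)) h)‖ ^ 2 =
      ∑ U ∈ cliques Γ, (-1 : ℝ) ^ U.card * ((r ^ 2) ^ length Γ (p * cliqueProd Γ U) *
        ‖star (T.rep (p * cliqueProd Γ U)) h‖ ^ 2) := by
    intro p
    rw [map_smul, norm_smul_sq, norm_sqrt_apply_sq hr, re_inner_defect, Finset.mul_sum]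
    refine Finset.sum_congr rfl fun U _ => ?_
    rw [length_mul, length_cliqueProd, star_rep_mul_apply, pow_add]
    ring
  simp only [e] at hK2
  have := hK2.unique hM
  simp only [length_one, pow_zero, one_mul, map_one, star_one, one_apply_eq_self] at this
  exact (pow_left_inj₀ (norm_nonneg _) (norm_nonneg _) two_ne_zero).1 this

theorem WeakBrehmer.adjoint_comp_poissonKernel [Finite V] {T : GammaFamily Γ H}
    (hT : T.WeakBrehmer) {r : ℝ} (h0 : 0 ≤ r) (h1 : r < 1) (hr : 0 ≤ T.defect r) :
    (ContinuousLinearMap.adjoint (T.poissonKernel r)).comp (T.poissonKernel r) = 1 :=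
  (ContinuousLinearMap.norm_map_iff_adjoint_comp_self _).1
    (hT.norm_poissonKernel_apply h0 h1 hr)

theorem WeakBrehmer.star_leftRegular_poissonKernel [Finite V] {T : GammaFamily Γ H}
    (hT : T.WeakBrehmer) {r : ℝ} (h0 : 0 ≤ r) (h1 : r < 1) (q : RAAM Γ) :
    (hTensorOp (star (leftRegular q)) 1).comp (T.poissonKernel r) =
      ((r : ℂ) ^ length Γ q) • (T.poissonKernel r).comp (star (T.rep q)) := by
  rw [poissonKernel, ← ContinuousLinearMap.comp_assoc, hTensorOp_comm,
    ContinuousLinearMap.comp_assoc, (hT.isCauchyTransform h0 h1).star_leftRegular_apply,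
    ContinuousLinearMap.comp_smul, ContinuousLinearMap.comp_assoc]

/-- The map `a ↦ K_{r,T}^* (a ⊗ I) K_{r,T}` on all of `B(ℓ²(A_Γ⁺))`. -/
def poissonOp [Finite V] (T : GammaFamily Γ H) (r : ℝ) :
    (ELL2 (RAAM Γ) →L[ℂ] ELL2 (RAAM Γ)) →ₗ[ℂ] (H →L[ℂ] H) where
  toFun a := (ContinuousLinearMap.adjoint (T.poissonKernel r)).comp
    ((hTensorAmplify _ _ a).comp (T.poissonKernel r))
  map_add' a b := by simp only [map_add, ContinuousLinearMap.add_comp, ContinuousLinearMap.comp_add]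
  map_smul' c a := by
    simp only [map_smul, ContinuousLinearMap.smul_comp, ContinuousLinearMap.comp_smul,
      RingHom.id_apply]

theorem poissonOp_apply [Finite V] (T : GammaFamily Γ H) (r : ℝ)
    (a : ELL2 (RAAM Γ) →L[ℂ] ELL2 (RAAM Γ)) :
    T.poissonOp r a = (ContinuousLinearMap.adjoint (T.poissonKernel r)).comp
      ((hTensorAmplify _ _ a).comp (T.poissonKernel r)) := rfl

/-- The intertwining relation moves `λ_q^*` through `K` on the right, its adjoint moves `λ_p`
through `K^*` on the left, and `K^* K = 1` remains. -/
theorem WeakBrehmer.poissonOp_leftRegular [Finite V] {T : GammaFamily Γ H}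
    (hT : T.WeakBrehmer) {r : ℝ} (h0 : 0 ≤ r) (h1 : r < 1) (hr : 0 ≤ T.defect r)
    (p q : RAAM Γ) :
    T.poissonOp r (leftRegular p * star (leftRegular q)) =
      (r : ℂ) ^ (length Γ p + length Γ q) • (T.rep p * star (T.rep q)) := by
  have hp := congrArg ContinuousLinearMap.adjoint (hT.star_leftRegular_poissonKernel h0 h1 p)
  rw [ContinuousLinearMap.adjoint_comp, map_smulₛₗ, ContinuousLinearMap.adjoint_comp,
    ← ContinuousLinearMap.star_eq_adjoint (hTensorOp _ _), adjoint_hTensorOp, star_star,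
    star_one, ← ContinuousLinearMap.star_eq_adjoint (star _), star_star, map_pow,
    Complex.conj_ofReal] at hp
  rw [poissonOp_apply, map_mul, hTensorAmplify_apply, hTensorAmplify_apply,
    ContinuousLinearMap.mul_def, ContinuousLinearMap.comp_assoc,
    hT.star_leftRegular_poissonKernel h0 h1, ← ContinuousLinearMap.comp_assoc, hp,
    ContinuousLinearMap.comp_smul, ContinuousLinearMap.smul_comp, smul_smul,
    ContinuousLinearMap.comp_assoc, ← ContinuousLinearMap.comp_assoc (ContinuousLinearMap.adjoint _),
    hT.adjoint_comp_poissonKernel h0 h1 hr, pow_add, mul_comm]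
  rfl

end GammaFamily

/-! ### A spanning set of the reduced semigroup C*-algebra -/

namespace RAAM

variable {V : Type*} {Γ : SimpleGraph V}

/-- Adjacent generators doubly commute, and nonadjacent ones have isometries with orthogonal ranges.
This is what allows adjoints to be moved to the right of every word. -/
theorem star_leftRegular_gen_mul {i j : V} (hij : i ≠ j) :
    star (leftRegular (gen Γ i)) * leftRegular (gen Γ j) =
      if Γ.Adj i j then leftRegular (gen Γ j) * star (leftRegular (gen Γ i)) else 0 := by
  refine ell2_ext fun x => ?_
  rw [mul_apply_eq_comp, leftRegular_ell2Basis]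
  by_cases hx : gen Γ i ∣ gen Γ j * x
  · obtain ⟨y, hy⟩ := hx
    obtain ⟨hadj, z, rfl, rfl⟩ := exists_of_gen_mul_eq hij hy.symm
    rw [if_pos hadj, hy, star_leftRegular_mul, mul_apply_eq_comp, star_leftRegular_mul,
      leftRegular_ell2Basis]
  · rw [star_leftRegular_of_not_dvd hx]
    split_ifs with hadj
    · rw [mul_apply_eq_comp, star_leftRegular_of_not_dvd, map_zero]
      rintro ⟨y, rfl⟩
      exact hx ⟨gen Γ j * y, by rw [← mul_assoc, ← mul_assoc, gen_comm hadj]⟩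
    · rfl

variable (Γ) in
/-- The linear span of the operators `λ_p λ_q^*`. -/
def regularSpan : Submodule ℂ (ELL2 (RAAM Γ) →L[ℂ] ELL2 (RAAM Γ)) :=
  Submodule.span ℂ (Set.range fun x : RAAM Γ × RAAM Γ =>
    leftRegular x.1 * star (leftRegular x.2))

theorem mem_regularSpan (p q : RAAM Γ) :
    leftRegular p * star (leftRegular q) ∈ regularSpan Γ :=
  Submodule.subset_span ⟨(p, q), rfl⟩

theorem mul_mem_regularSpan {x y : ELL2 (RAAM Γ) →L[ℂ] ELL2 (RAAM Γ)}
    (h : ∀ p q : RAAM Γ, x * (leftRegular p * star (leftRegular q)) ∈ regularSpan Γ)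
    (hy : y ∈ regularSpan Γ) : x * y ∈ regularSpan Γ := by
  induction hy using Submodule.span_induction with
  | mem y hy =>
    obtain ⟨⟨p, q⟩, rfl⟩ := hy
    exact h p q
  | zero => rw [mul_zero]; exact zero_mem _
  | add y z _ _ hy hz => rw [mul_add]; exact add_mem hy hz
  | smul c y _ hy => rw [mul_smul_comm]; exact Submodule.smul_mem _ _ hy

theorem leftRegular_mul_mem (r : RAAM Γ) {y : ELL2 (RAAM Γ) →L[ℂ] ELL2 (RAAM Γ)}
    (hy : y ∈ regularSpan Γ) : leftRegular r * y ∈ regularSpan Γ :=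
  mul_mem_regularSpan (fun p q => by
    rw [← mul_assoc, ← leftRegular_mul]
    exact mem_regularSpan _ _) hy

theorem star_leftRegular_mul_mem (r : RAAM Γ) {y : ELL2 (RAAM Γ) →L[ℂ] ELL2 (RAAM Γ)}
    (hy : y ∈ regularSpan Γ) : star (leftRegular r) * y ∈ regularSpan Γ := by
  induction r using induction_gen_mul generalizing y with
  | one => rwa [leftRegular_one, star_one, one_mul]
  | gen_mul i r ih =>
    rw [leftRegular_mul, star_mul, mul_assoc]
    refine ih (mul_mem_regularSpan (fun p q => ?_) hy)
    induction p using induction_gen_mul with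
    | one =>
      rw [leftRegular_one, one_mul, ← star_mul, ← leftRegular_mul]
      simpa [leftRegular_one] using mem_regularSpan 1 (q * gen Γ i)
    | gen_mul j p ihp =>
      rw [leftRegular_mul]
      by_cases hij : i = j
      · subst hij
        rw [mul_assoc, ← mul_assoc (star _), star_leftRegular_mul_self, one_mul]
        exact mem_regularSpan _ _
      · rw [mul_assoc, ← mul_assoc (star _), star_leftRegular_gen_mul hij]
        split_ifs
        · rw [mul_assoc]
          exact leftRegular_mul_mem _ ihp
        · rw [zero_mul]
          exact zero_mem _

theorem mem_closure_regularSpan {a : ELL2 (RAAM Γ) →L[ℂ] ELL2 (RAAM Γ)}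
    (ha : a ∈ reducedCStar (RAAM Γ)) :
    a ∈ closure (regularSpan Γ : Set (ELL2 (RAAM Γ) →L[ℂ] ELL2 (RAAM Γ))) := by
  refine closure_mono (fun x hx => ?_)
    (show a ∈ closure (StarAlgebra.adjoin ℂ (Set.range (leftRegular (P := RAAM Γ))) :
      Set (ELL2 (RAAM Γ) →L[ℂ] ELL2 (RAAM Γ))) from ha)
  have hx' : x ∈ Algebra.adjoin ℂ (Set.range (leftRegular (P := RAAM Γ)) ∪
      star (Set.range (leftRegular (P := RAAM Γ)))) := hx
  -- Invariance of the span under left multiplication suffices, since the span contains `1`; it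
  -- never has to be shown closed under products directly.
  suffices key : ∀ y ∈ regularSpan Γ, x * y ∈ regularSpan Γ by
    simpa [leftRegular_one] using key _ (mem_regularSpan 1 1)
  clear hx
  induction hx' using Algebra.adjoin_induction with
  | mem x hx =>
    intro y hy
    rcases hx with ⟨p, rfl⟩ | ⟨p, hp⟩
    · exact leftRegular_mul_mem p hy
    · rw [← star_star x, ← hp]
      exact star_leftRegular_mul_mem p hy
  | algebraMap c =>
    intro y hy
    rw [Algebra.algebraMap_eq_smul_one, smul_mul_assoc, one_mul]
    exact Submodule.smul_mem _ _ hy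
  | add x z _ _ hx hz =>
    intro y hy
    rw [add_mul]
    exact add_mem (hx y hy) (hz y hy)
  | mul x z _ _ hx hz =>
    intro y hy
    rw [mul_assoc]
    exact hx _ (hz y hy)

end RAAM

/-! ### Matrices of operators -/

section MatrixOp

variable {E F : Type*} [NormedAddCommGroup E] [InnerProductSpace ℂ E]
  [NormedAddCommGroup F] [InnerProductSpace ℂ F] {n : ℕ}

/-- The operator on `E^n` given by a matrix of operators on `E`. -/
def matrixOp (M : CStarMatrix (Fin n) (Fin n) (E →L[ℂ] E)) :
    PiLp 2 (fun _ : Fin n => E) →L[ℂ] PiLp 2 (fun _ : Fin n => E) :=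
  ((PiLp.continuousLinearEquiv 2 ℂ fun _ : Fin n => E).symm : _ →L[ℂ] _).comp
    (ContinuousLinearMap.pi fun i => ∑ j, (M i j).comp (PiLp.proj 2 (fun _ : Fin n => E) j))

theorem matrixOp_apply (M : CStarMatrix (Fin n) (Fin n) (E →L[ℂ] E))
    (x : PiLp 2 (fun _ : Fin n => E)) (i : Fin n) : matrixOp M x i = ∑ j, M i j (x j) := by
  simp [matrixOp]

theorem inner_matrixOp (M : CStarMatrix (Fin n) (Fin n) (E →L[ℂ] E))
    (x y : PiLp 2 (fun _ : Fin n => E)) :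
    inner ℂ (matrixOp M x) y = ∑ i, ∑ j, inner ℂ (M i j (x j)) (y i) := by
  simp only [PiLp.inner_apply, matrixOp_apply, sum_inner]

variable [CompleteSpace E] [CompleteSpace F]

variable (E n) in
/-- The representation of `M_n(B(E))` on `E^n`. -/
def matrixRep : CStarMatrix (Fin n) (Fin n) (E →L[ℂ] E) →⋆ₙₐ[ℂ]
    (PiLp 2 (fun _ : Fin n => E) →L[ℂ] PiLp 2 (fun _ : Fin n => E)) where
  toFun := matrixOp
  map_smul' c M := by
    ext x i
    simp [matrixOp_apply, Finset.smul_sum]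
  map_zero' := by
    ext x i
    simp [matrixOp_apply]
  map_add' M N := by
    ext x i
    simp [matrixOp_apply, Finset.sum_add_distrib]
  map_mul' M N := by
    ext x i
    simp only [matrixOp_apply, mul_apply_eq_comp, CStarMatrix.mul_apply, sum_apply, map_sum]
    exact Finset.sum_comm
  map_star' M := by
    rw [ContinuousLinearMap.star_eq_adjoint, ContinuousLinearMap.eq_adjoint_iff]
    intro x y
    rw [inner_matrixOp, ← inner_conj_symm, inner_matrixOp, map_sum, Finset.sum_comm]
    refine Finset.sum_congr rfl fun i _ => ?_
    rw [map_sum]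
    refine Finset.sum_congr rfl fun j _ => ?_
    rw [CStarMatrix.star_apply, ContinuousLinearMap.star_eq_adjoint,
      ContinuousLinearMap.adjoint_inner_left, inner_conj_symm]

theorem matrixRep_injective : Function.Injective (matrixRep E n) := by
  intro M N h
  ext i j e
  have := congrArg (fun A => A (WithLp.toLp 2 (Pi.single j e)) i) h
  simpa [matrixRep, matrixOp_apply, Pi.single_apply, apply_ite] using this

/-- An injective `*`-homomorphism of C*-algebras is isometric, so the matrix norm can be computed on
`E^n`. -/
theorem norm_matrixOp (M : CStarMatrix (Fin n) (Fin n) (E →L[ℂ] E)) : ‖matrixOp M‖ = ‖M‖ :=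
  NonUnitalStarAlgHom.norm_map (matrixRep E n) matrixRep_injective M

/-- The compressed matrix is `D^* M D`, where `D` applies the isometry `K` to each coordinate. -/
theorem norm_map_adjoint_comp_le {K : E →L[ℂ] F} (hK : ∀ x, ‖K x‖ = ‖x‖)
    (M : CStarMatrix (Fin n) (Fin n) (F →L[ℂ] F)) :
    ‖M.map fun a => (ContinuousLinearMap.adjoint K).comp (a.comp K)‖ ≤ ‖M‖ := by
  rw [← norm_matrixOp, ← norm_matrixOp M]
  let D : PiLp 2 (fun _ : Fin n => E) → PiLp 2 (fun _ : Fin n => F) :=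
    fun x => WithLp.toLp 2 fun i => K (x i)
  have hD : ∀ x, ‖D x‖ = ‖x‖ := fun x => by
    simp only [PiLp.norm_eq_of_L2, D, hK]
  have hin : ∀ x y, inner ℂ (matrixOp (M.map fun a =>
      (ContinuousLinearMap.adjoint K).comp (a.comp K)) x) y =
      inner ℂ (matrixOp M (D x)) (D y) := by
    intro x y
    rw [inner_matrixOp, inner_matrixOp]
    refine Finset.sum_congr rfl fun i _ => Finset.sum_congr rfl fun j _ => ?_
    rw [CStarMatrix.map_apply, ContinuousLinearMap.comp_apply,
      ContinuousLinearMap.adjoint_inner_left]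
    rfl
  refine ContinuousLinearMap.opNorm_le_bound _ (norm_nonneg _) fun x => ?_
  set y := matrixOp (M.map fun a => (ContinuousLinearMap.adjoint K).comp (a.comp K)) x with hy
  rcases (norm_nonneg y).eq_or_lt with h0 | h0
  · rw [← h0]
    positivity
  · refine le_of_mul_le_mul_right ?_ h0
    calc ‖y‖ * ‖y‖ = ‖inner ℂ y y‖ := by
          rw [inner_self_eq_norm_sq_to_K]
          simp [sq]
      _ = ‖inner ℂ (matrixOp M (D x)) (D y)‖ := by rw [← hin, ← hy]
      _ ≤ ‖matrixOp M (D x)‖ * ‖D y‖ := norm_inner_le_norm _ _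
      _ ≤ ‖matrixOp M‖ * ‖x‖ * ‖y‖ := by
          rw [hD y, ← hD x]
          exact mul_le_mul_of_nonneg_right ((matrixOp M).le_opNorm _) (norm_nonneg _)

end MatrixOp

/-! ### Limits of uniformly bounded linear maps -/

/-- If `b` is near `a` and `f r b` converges to `L`, contractivity traps `f r a` eventually in a
small ball about `L`; hence `f r a` is Cauchy. -/
theorem isClosed_setOf_exists_tendsto {ι A B : Type*} [SeminormedAddCommGroup A] [Module ℂ A]
    [NormedAddCommGroup B] [Module ℂ B] [CompleteSpace B] {l : Filter ι} [l.NeBot]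
    {f : ι → A →ₗ[ℂ] B} (hf : ∀ᶠ r in l, ∀ a, ‖f r a‖ ≤ ‖a‖) :
    IsClosed {a | ∃ L, Filter.Tendsto (fun r => f r a) l (nhds L)} := by
  refine isClosed_of_closure_subset fun a ha => ?_
  rw [Set.mem_ofPred_eq, ← cauchy_map_iff_exists_tendsto, Metric.cauchy_iff]
  refine ⟨inferInstance, fun ε hε => ?_⟩
  obtain ⟨b, ⟨L, hL⟩, hb⟩ := Metric.mem_closure_iff.1 ha (ε / 4) (by positivity)
  refine ⟨Metric.ball L (ε / 2), ?_, fun x hx y hy => ?_⟩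
  · rw [Filter.mem_map]
    filter_upwards [hf, hL (Metric.ball_mem_nhds L (ε := ε / 4) (by positivity))] with r h1 h2
    rw [Set.mem_preimage, Metric.mem_ball] at h2 ⊢
    have h3 : dist (f r a) (f r b) ≤ dist a b := by
      rw [dist_eq_norm, dist_eq_norm, ← map_sub]
      exact h1 _
    linarith [dist_triangle (f r a) (f r b) L]
  · rw [Metric.mem_ball] at hx hy
    linarith [dist_triangle_right x y L]

/-! ### The Poisson transform as a limit -/

namespace GammaFamily

open RAAM Filter

variable {V : Type*} {Γ : SimpleGraph V} {H : Type*} [NormedAddCommGroup H]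
  [InnerProductSpace ℂ H] [CompleteSpace H]

/-- The amplification `a ↦ a ⊗ I` is a `*`-homomorphism, hence contractive at every matrix level,
and it is followed by compression with the isometry `K_r`. -/
theorem WeakBrehmer.norm_map_poissonOp_le [Finite V] {T : GammaFamily Γ H}
    (hT : T.WeakBrehmer) {r : ℝ} (h0 : 0 ≤ r) (h1 : r < 1) (hr : 0 ≤ T.defect r) {n : ℕ}
    (M : CStarMatrix (Fin n) (Fin n) (ELL2 (RAAM Γ) →L[ℂ] ELL2 (RAAM Γ))) :
    ‖M.map fun a => T.poissonOp r a‖ ≤ ‖M‖ :=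
  (norm_map_adjoint_comp_le (hT.norm_poissonKernel_apply h0 h1 hr)
    (M.map fun a => hTensorAmplify _ _ a)).trans
    (NonUnitalStarAlgHom.norm_apply_le (CStarMatrix.mapₙₐ (n := Fin n)
      (hTensorAmplify (ELL2 (RAAM Γ)) H).toNonUnitalStarAlgHom) M)

theorem WeakBrehmer.norm_poissonOp_le [Finite V] {T : GammaFamily Γ H}
    (hT : T.WeakBrehmer) {r : ℝ} (h0 : 0 ≤ r) (h1 : r < 1) (hr : 0 ≤ T.defect r)
    (a : ELL2 (RAAM Γ) →L[ℂ] ELL2 (RAAM Γ)) : ‖T.poissonOp r a‖ ≤ ‖a‖ := by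
  have hK : ‖T.poissonKernel r‖ ≤ 1 :=
    ContinuousLinearMap.opNorm_le_bound _ zero_le_one fun x => by
      rw [hT.norm_poissonKernel_apply h0 h1 hr, one_mul]
  have hA : ‖hTensorAmplify (ELL2 (RAAM Γ)) H a‖ ≤ ‖a‖ :=
    NonUnitalStarAlgHom.norm_apply_le (hTensorAmplify (ELL2 (RAAM Γ)) H) a
  rw [poissonOp_apply]
  calc _ ≤ ‖ContinuousLinearMap.adjoint (T.poissonKernel r)‖ *
        (‖hTensorAmplify (ELL2 (RAAM Γ)) H a‖ * ‖T.poissonKernel r‖) :=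
        (ContinuousLinearMap.opNorm_comp_le _ _).trans
          (mul_le_mul_of_nonneg_left (ContinuousLinearMap.opNorm_comp_le _ _) (norm_nonneg _))
    _ ≤ 1 * (‖a‖ * 1) := by
        rw [LinearIsometryEquiv.norm_map]
        gcongr
    _ = ‖a‖ := by ring

theorem PropertyP.eventually [Finite V] {T : GammaFamily Γ H} (hP : T.PropertyP) :
    ∀ᶠ r in nhdsWithin (1 : ℝ) (Set.Iio 1), 0 ≤ r ∧ r < 1 ∧ 0 ≤ T.defect r := by
  obtain ⟨ρ, h0, h1, h⟩ := hP
  filter_upwards [Ioo_mem_nhdsLT h1] with r hr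
  exact ⟨h0.trans hr.1.le, hr.2, h r hr.1 hr.2⟩

theorem WeakBrehmer.tendsto_poissonOp_leftRegular [Finite V] {T : GammaFamily Γ H}
    (hT : T.WeakBrehmer) (hP : T.PropertyP) (p q : RAAM Γ) :
    Tendsto (fun r => T.poissonOp r (leftRegular p * star (leftRegular q)))
      (nhdsWithin (1 : ℝ) (Set.Iio 1)) (nhds (T.rep p * star (T.rep q))) := by
  have h1 : Tendsto (fun r : ℝ => (r : ℂ) ^ (length Γ p + length Γ q) •
      (T.rep p * star (T.rep q))) (nhds 1) (nhds (T.rep p * star (T.rep q))) := by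
    have : Continuous fun r : ℝ => (r : ℂ) ^ (length Γ p + length Γ q) •
        (T.rep p * star (T.rep q)) := by fun_prop
    simpa using this.tendsto 1
  refine (h1.mono_left nhdsWithin_le_nhds).congr' ?_
  filter_upwards [hP.eventually] with r hr
  exact (hT.poissonOp_leftRegular hr.1 hr.2.1 hr.2.2 p q).symm

theorem WeakBrehmer.exists_tendsto_poissonOp [Finite V] {T : GammaFamily Γ H}
    (hT : T.WeakBrehmer) (hP : T.PropertyP) {a : ELL2 (RAAM Γ) →L[ℂ] ELL2 (RAAM Γ)}
    (ha : a ∈ reducedCStar (RAAM Γ)) :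
    ∃ L, Tendsto (fun r => T.poissonOp r a) (nhdsWithin (1 : ℝ) (Set.Iio 1)) (nhds L) := by
  have hcl := isClosed_setOf_exists_tendsto (l := nhdsWithin (1 : ℝ) (Set.Iio 1))
    (f := T.poissonOp) (by
      filter_upwards [hP.eventually] with r hr a
      exact hT.norm_poissonOp_le hr.1 hr.2.1 hr.2.2 a)
  refine closure_minimal (fun x hx => ?_) hcl (mem_closure_regularSpan ha)
  induction hx using Submodule.span_induction with
  | mem x hx =>
    obtain ⟨⟨p, q⟩, rfl⟩ := hx
    exact ⟨_, hT.tendsto_poissonOp_leftRegular hP p q⟩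
  | zero => exact ⟨0, by simpa only [map_zero] using tendsto_const_nhds⟩
  | add x y _ _ hx hy =>
    obtain ⟨L, hL⟩ := hx
    obtain ⟨M, hM⟩ := hy
    exact ⟨L + M, by simpa only [map_add] using hL.add hM⟩
  | smul c x _ hx =>
    obtain ⟨L, hL⟩ := hx
    exact ⟨c • L, by simpa only [map_smul] using hL.const_smul c⟩

theorem WeakBrehmer.exists_poissonTransform [Finite V] {T : GammaFamily Γ H}
    (hT : T.WeakBrehmer) (hP : T.PropertyP) :
    ∃ Φ : reducedCStar (RAAM Γ) →ₗ[ℂ] (H →L[ℂ] H), ∀ a : reducedCStar (RAAM Γ),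
      Tendsto (fun r : ℝ => T.poissonMap r a) (nhdsWithin (1 : ℝ) (Set.Iio 1)) (nhds (Φ a)) := by
  choose Φ hΦ using fun a : reducedCStar (RAAM Γ) => hT.exists_tendsto_poissonOp hP a.2
  refine ⟨{ toFun := Φ, map_add' := fun a b => ?_, map_smul' := fun c a => ?_ }, hΦ⟩
  · refine tendsto_nhds_unique (hΦ (a + b)) ?_
    simpa only [AddMemClass.coe_add, map_add] using (hΦ a).add (hΦ b)
  · refine tendsto_nhds_unique (hΦ (c • a)) ?_
    have := (hΦ a).const_smul c
    simp only [← map_smul] at this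
    exact this

theorem WeakBrehmer.isCompletelyContractive [Finite V] {T : GammaFamily Γ H}
    (hT : T.WeakBrehmer) (hP : T.PropertyP)
    {Φ : reducedCStar (RAAM Γ) →ₗ[ℂ] (H →L[ℂ] H)} (hΦ : ∀ a : reducedCStar (RAAM Γ),
      Tendsto (fun r : ℝ => T.poissonMap r a) (nhdsWithin (1 : ℝ) (Set.Iio 1)) (nhds (Φ a))) :
    IsCompletelyContractive (reducedCStar (RAAM Γ)) Φ := by
  intro n a
  have h1 : Tendsto (fun r => CStarMatrix.ofMatrix (a.map fun x => T.poissonMap r x))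
      (nhdsWithin (1 : ℝ) (Set.Iio 1)) (nhds (CStarMatrix.ofMatrix (a.map fun x => Φ x))) :=
    -- The topology of the matrix C*-algebra is that of entrywise convergence.
    tendsto_pi_nhds.2 fun i => tendsto_pi_nhds.2 fun j => hΦ (a i j)
  refine le_of_tendsto h1.norm ?_
  filter_upwards [hP.eventually] with r hr
  exact hT.norm_map_poissonOp_le hr.1 hr.2.1 hr.2.2
    (CStarMatrix.ofMatrix (a.map fun x => (x : ELL2 (RAAM Γ) →L[ℂ] ELL2 (RAAM Γ))))

end GammaFamily

end

theorem mainTheorem2 {V : Type*} [Finite V] (Γ : SimpleGraph V)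
    {H : Type*} [NormedAddCommGroup H] [InnerProductSpace ℂ H] [CompleteSpace H]
    (T : GammaFamily Γ H) (hB : T.WeakBrehmer) (hP : T.PropertyP) :
    (∀ r : ℝ, 0 ≤ r → r < 1 → T.IsCauchyTransform r (T.cauchyTransform r)) ∧
    ∃ Φ : reducedCStar (RAAM Γ) →ₗ[ℂ] (H →L[ℂ] H),
      (∀ a : reducedCStar (RAAM Γ),
        Filter.Tendsto (fun r : ℝ => T.poissonMap r a)
          (nhdsWithin (1 : ℝ) (Set.Iio 1)) (nhds (Φ a))) ∧
      (∀ p q : RAAM Γ, Φ (regElem p * star (regElem q)) = T.rep p * star (T.rep q)) ∧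
      (Φ 1 = 1 ∧ IsCompletelyContractive (reducedCStar (RAAM Γ)) Φ) ∧
      (∀ p q : RAAM Γ, Φ (regElem p) * Φ (regElem q) = Φ (regElem (p * q))) := by
  refine ⟨fun r h0 h1 => hB.isCauchyTransform h0 h1, ?_⟩
  obtain ⟨Φ, hΦ⟩ := hB.exists_poissonTransform hP
  have hone : (regElem 1 : reducedCStar (RAAM Γ)) = 1 := Subtype.ext leftRegular_one
  have hpq : ∀ p q : RAAM Γ, Φ (regElem p * star (regElem q)) = T.rep p * star (T.rep q) :=
    fun p q => tendsto_nhds_unique (hΦ _) (hB.tendsto_poissonOp_leftRegular hP p q)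
  -- The case `q = 1`, from which unitality and multiplicativity follow because `T.rep` is a
  -- homomorphism.
  have hp : ∀ p : RAAM Γ, Φ (regElem p) = T.rep p := fun p => by
    simpa [hone] using hpq p 1
  refine ⟨Φ, hΦ, hpq, ⟨?_, hB.isCompletelyContractive hP hΦ⟩, fun p q => ?_⟩
  · rw [← hone, hp, map_one]
  · rw [hp, hp, hp, map_mul]
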